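/- A graphon is a measurable symmetric function $W:[0,1]^2\to[0,1]$. Its operator on the real space $L^2([0,1])$ is $(T_WX)(v)=\int_0^1 W(u,v)X(u)\,du$. Its eigenvalues, counted with multiplicity, are indexed by the nonzero integers so that $\lambda_1(W)\ge\lambda_2(W)\ge\cdots\ge 0\ge\cdots\ge\lambda_{-2}(W)\ge\lambda_{-1}(W)$, and each of the two sequences is continued by zeros if it is finite. A graph $G_n$ on $n$ nodes is randomly sampled from $W$ by drawing $u_1,\dots,u_n$ independently and uniformly from $[0,1]$ and then either (a) giving each edge $\{i,j\}$ the weight $W(u_i,u_j)$, or (b) connecting the pairs $\{i,j\}$ by unweighted edges, independently given $u_1,\dots,u_n$, with probability $W(u_i,u_j)$. In both cases the pairs with $i=j$ may be either treated like all others or left out (zero diagonal). If $A$ is the adjacency matrix of $G_n$, the induced graphon is $W_{G_n}(u,v)=\sum_{j,k=1}^n A_{jk}\,\mathbb 1(u\in I_j)\,\mathbb 1(v\in I_k)$, where $I_j=[(j-1)/n,j/n)$ for $j<n$ and $I_n=[(n-1)/n,1]$. **Proposition (Lipschitz case).** If $G_n$ is randomly sampled from a Lipschitz graphon $W$, then with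 high probability $|\lambda_i(W_{G_n})-\lambda_i(W)|=\mathcal O\big(\sqrt{\log n/n}\big)$. Precisely: for every $L\ge 0$ and every $\kappa>0$ there is a constant $C>0$, depending only on $L$ and $\kappa$, such that for every graphon $W$ that is $L$-Lipschitz on $[0,1]^2$ (with the maximum metric), for either way (a), (b) of sampling, with or without loops, and for every $n\ge 2$, $$\Pr\Big(\,|\lambda_i(W_{G_n})-\lambda_i(W)|\le C\sqrt{\tfrac{\log n}{n}}\ \text{ for all } i\in\mathbb Z\setminus\{0\}\Big)\ \ge\ 1-n^{-\kappa}.$$ -/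

import Mathlib

open MeasureTheory unitInterval
open scoped NNReal ENNReal

/-- A graphon: a measurable symmetric function `[0,1]² → [0,1]`. -/
structure Graphon where
  /-- The underlying function. -/
  toFun : I → I → ℝ
  measurable' : Measurable (fun p : I × I => toFun p.1 p.2)
  symm' : ∀ x y, toFun x y = toFun y x
  nonneg' : ∀ x y, 0 ≤ toFun x y
  le_one' : ∀ x y, toFun x y ≤ 1

namespace Graphon

instance : CoeFun Graphon (fun _ => I → I → ℝ) := ⟨Graphon.toFun⟩

/-- The Hilbert space `L²([0,1])` of real functions. -/
abbrev L2I : Type := Lp ℝ 2 (volume : Measure I)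

theorem norm_le_one (W : Graphon) (x y : I) : ‖W x y‖ ≤ 1 := by
  rw [Real.norm_eq_abs, abs_of_nonneg (W.nonneg' x y)]
  exact W.le_one' x y

theorem integrable_L2I (X : L2I) : Integrable (X : I → ℝ) volume :=
  (Lp.memLp X).integrable (by norm_num)

theorem integrable_kernel_mul (W : Graphon) (X : L2I) (v : I) :
    Integrable (fun u : I => W u v * X u) volume := by
  refine (integrable_L2I X).bdd_mul (c := 1) ?_ ?_
  · exact (W.measurable'.comp (measurable_id.prodMk measurable_const)).aestronglyMeasurable
  · exact Filter.Eventually.of_forall fun u => W.norm_le_one u v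

theorem integral_norm_le (X : L2I) : ∫ u, ‖X u‖ ∂(volume : Measure I) ≤ ‖X‖ := by
  have h1 : eLpNorm (X : I → ℝ) 1 volume ≤ eLpNorm (X : I → ℝ) 2 volume :=
    eLpNorm_le_eLpNorm_of_exponent_le (by norm_num) (Lp.aestronglyMeasurable X)
  rw [integral_norm_eq_lintegral_enorm (Lp.aestronglyMeasurable X), Lp.norm_def]
  rw [eLpNorm_one_eq_lintegral_enorm] at h1
  exact ENNReal.toReal_mono (Lp.eLpNorm_ne_top X) h1

theorem norm_integral_kernel_mul_le (W : Graphon) (X : L2I) (v : I) :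
    ‖∫ u : I, W u v * X u‖ ≤ ‖X‖ := by
  refine (norm_integral_le_integral_norm _).trans (le_trans ?_ (integral_norm_le X))
  refine integral_mono (W.integrable_kernel_mul X v).norm (integrable_L2I X).norm fun u => ?_
  simp only [norm_mul]
  exact mul_le_of_le_one_left (norm_nonneg _) (W.norm_le_one u v)

theorem memLp_integral_kernel_mul (W : Graphon) (X : L2I) :
    MemLp (fun v : I => ∫ u : I, W u v * X u) 2 volume := by
  refine MemLp.of_bound ?_ ‖X‖ (Filter.Eventually.of_forall (W.norm_integral_kernel_mul_le X))
  have h : StronglyMeasurable (fun p : I × I => W p.1 p.2 * X p.1) :=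
    W.measurable'.stronglyMeasurable.mul
      ((Lp.stronglyMeasurable X).comp_measurable measurable_fst)
  exact (h.integral_prod_left').aestronglyMeasurable

/-- The graphon operator `(T_W X)(v) = ∫₀¹ W(u, v) X(u) du` on `L²([0,1])`. -/
noncomputable def operator (W : Graphon) : L2I →L[ℝ] L2I :=
  LinearMap.mkContinuous
    { toFun := fun X => (W.memLp_integral_kernel_mul X).toLp _
      map_add' := fun X Y => by
        rw [← MemLp.toLp_add]
        refine MemLp.toLp_congr _ _ (Filter.Eventually.of_forall fun v => ?_)
        simp only [Pi.add_apply]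
        rw [← integral_add (W.integrable_kernel_mul X v) (W.integrable_kernel_mul Y v)]
        refine integral_congr_ae ?_
        filter_upwards [Lp.coeFn_add X Y] with u hu
        rw [hu, Pi.add_apply, mul_add]
      map_smul' := fun c X => by
        rw [RingHom.id_apply, ← MemLp.toLp_const_smul]
        refine MemLp.toLp_congr _ _ (Filter.Eventually.of_forall fun v => ?_)
        simp only [Pi.smul_apply, smul_eq_mul]
        rw [← integral_const_mul]
        refine integral_congr_ae ?_
        filter_upwards [Lp.coeFn_smul c X] with u hu
        rw [hu, Pi.smul_apply, smul_eq_mul]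
        ring }
    1
    (fun X => by
      have h := Lp.norm_le_of_ae_bound (f := (W.memLp_integral_kernel_mul X).toLp _)
        (norm_nonneg X) (by
          filter_upwards [(W.memLp_integral_kernel_mul X).coeFn_toLp] with v hv
          rw [hv]
          exact W.norm_integral_kernel_mul_le X v)
      have h1 : measureUnivNNReal (volume : Measure I) = 1 := by simp [measureUnivNNReal]
      rw [h1] at h
      simpa using h)

theorem operator_apply_ae (W : Graphon) (X : L2I) :
    ∀ᵐ v ∂(volume : Measure I), W.operator X v = ∫ u : I, W u v * X u :=
  (W.memLp_integral_kernel_mul X).coeFn_toLp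

end Graphon

/-- The `i`-th largest positive eigenvalue (`i ≥ 1`) of `T`, counted with multiplicity; it is `0`
if `T` has fewer than `i` positive eigenvalues. That is, the largest positive eigenvalue `μ` such
that the eigenspaces of eigenvalues `≥ μ` together span a space of dimension at least `i`. -/
noncomputable def posEigenvalue {E : Type*} [NormedAddCommGroup E] [NormedSpace ℝ E]
    (T : E →L[ℝ] E) (i : ℕ) : ℝ :=
  sSup {μ : ℝ | 0 < μ ∧ Module.End.HasEigenvalue (T : E →ₗ[ℝ] E) μ ∧
    (i : Cardinal) ≤
      Module.rank ℝ (⨆ ν ∈ Set.Ici μ, Module.End.eigenspace (T : E →ₗ[ℝ] E) ν : Submodule ℝ E)}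

/-- The eigenvalues of a graphon, indexed by the nonzero integers:
`λ₁ ≥ λ₂ ≥ ⋯ ≥ 0 ≥ ⋯ ≥ λ₋₂ ≥ λ₋₁`, with multiplicity, each of the two sequences being
continued by `0` if it is finite. (The value at `0` is not used.) -/
noncomputable def Graphon.eigenvalue (W : Graphon) (i : ℤ) : ℝ :=
  if 0 < i then posEigenvalue W.operator i.toNat
  else -posEigenvalue (-W.operator) (-i).toNat

/-- An undirected graph on `n` nodes with edge weights in `[0,1]`, given by its adjacency matrix. -/
structure WeightedGraph (n : ℕ) where
  /-- The adjacency matrix. -/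
  adj : Matrix (Fin n) (Fin n) ℝ
  symm' : ∀ i j, adj i j = adj j i
  nonneg' : ∀ i j, 0 ≤ adj i j
  le_one' : ∀ i j, adj i j ≤ 1

/-- The intervals of the regular partition of `[0,1]`, numbered from `0`: `[j/n, (j+1)/n)` for
`j + 1 < n`, and `[(n-1)/n, 1]` for the last one. -/
def regularCell (n : ℕ) (j : Fin n) : Set I :=
  {x | (j : ℝ) / n ≤ x ∧ ((x : ℝ) < ((j : ℝ) + 1) / n ∨ (j : ℕ) + 1 = n)}

theorem regularCell_unique {n : ℕ} {j k : Fin n} {x : I}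
    (hj : x ∈ regularCell n j) (hk : x ∈ regularCell n k) : j = k := by
  have hn : (0 : ℝ) < n := by exact_mod_cast j.pos
  have key : ∀ a b : Fin n, x ∈ regularCell n a → x ∈ regularCell n b → ¬ a < b := by
    intro a b ha hb hab
    have hab' : (a : ℕ) + 1 ≤ b := hab
    rcases ha.2 with h | h
    · have h2 := hb.1.trans_lt h
      rw [div_lt_div_iff_of_pos_right hn] at h2
      have : (a : ℝ) + 1 ≤ b := by exact_mod_cast hab'
      linarith
    · have := b.isLt
      omega
  exact le_antisymm (not_lt.1 (key k j hk hj)) (not_lt.1 (key j k hj hk))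

theorem measurableSet_regularCell (n : ℕ) (j : Fin n) : MeasurableSet (regularCell n j) := by
  unfold regularCell
  refine (measurableSet_le measurable_const measurable_subtype_coe).inter
    ((measurableSet_lt measurable_subtype_coe measurable_const).union (MeasurableSet.const _))

theorem sum_indicator_regularCell_le_one (n : ℕ) (x : I) :
    ∑ j : Fin n, (regularCell n j).indicator (fun _ => (1 : ℝ)) x ≤ 1 := by
  by_cases h : ∃ j, x ∈ regularCell n j
  · obtain ⟨j, hj⟩ := h
    rw [Finset.sum_eq_single j]
    · exact Set.indicator_le_self' (fun _ _ => zero_le_one) x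
    · intro k _ hk
      exact Set.indicator_of_notMem (fun hx => hk (regularCell_unique hx hj)) _
    · simp
  · push Not at h
    rw [Finset.sum_eq_zero fun j _ => Set.indicator_of_notMem (h j) _]
    exact zero_le_one

/-- The graphon induced by a graph: `∑ⱼ ∑ₖ A_{jk} 1(u ∈ Iⱼ) 1(v ∈ Iₖ)`. -/
noncomputable def WeightedGraph.inducedGraphon {n : ℕ} (G : WeightedGraph n) : Graphon where
  toFun u v := ∑ j : Fin n, ∑ k : Fin n, G.adj j k *
    (regularCell n j).indicator (fun _ => (1 : ℝ)) u *
    (regularCell n k).indicator (fun _ => (1 : ℝ)) v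
  measurable' := by
    refine Finset.measurable_sum _ fun j _ => Finset.measurable_sum _ fun k _ => ?_
    refine (measurable_const.mul ?_).mul ?_
    · exact (measurable_const.indicator (measurableSet_regularCell n j)).comp measurable_fst
    · exact (measurable_const.indicator (measurableSet_regularCell n k)).comp measurable_snd
  symm' u v := by
    rw [Finset.sum_comm]
    refine Finset.sum_congr rfl fun j _ => Finset.sum_congr rfl fun k _ => ?_
    rw [G.symm' k j]
    ring
  nonneg' u v := by
    refine Finset.sum_nonneg fun j _ => Finset.sum_nonneg fun k _ => ?_
    exact mul_nonneg (mul_nonneg (G.nonneg' j k)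
      (Set.indicator_nonneg (fun _ _ => zero_le_one) _))
      (Set.indicator_nonneg (fun _ _ => zero_le_one) _)
  le_one' u v := by
    have h0 : ∀ (w : I) (j : Fin n), 0 ≤ (regularCell n j).indicator (fun _ => (1 : ℝ)) w :=
      fun w j => Set.indicator_nonneg (fun _ _ => zero_le_one) _
    calc _ ≤ ∑ j : Fin n, ∑ k : Fin n, (regularCell n j).indicator (fun _ => (1 : ℝ)) u *
              (regularCell n k).indicator (fun _ => (1 : ℝ)) v := by
            refine Finset.sum_le_sum fun j _ => Finset.sum_le_sum fun k _ => ?_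
            exact mul_le_mul_of_nonneg_right
              (mul_le_of_le_one_left (h0 u j) (G.le_one' j k)) (h0 v k)
      _ = (∑ j : Fin n, (regularCell n j).indicator (fun _ => (1 : ℝ)) u) *
            ∑ k : Fin n, (regularCell n k).indicator (fun _ => (1 : ℝ)) v := by
            rw [Finset.sum_mul_sum]
      _ ≤ 1 := mul_le_one₀ (sum_indicator_regularCell_le_one n u)
            (Finset.sum_nonneg fun k _ => h0 v k) (sum_indicator_regularCell_le_one n v)

/-- The complete weighted graph sampled from `W` at the points `u₁, …, uₙ`: the edge `(i, j)` has
weight `W(uᵢ, uⱼ)`. `loops` says whether the pairs `(i, i)` are treated as edges too;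
if not, the diagonal of the adjacency matrix is zero. -/
noncomputable def Graphon.weightedSample (W : Graphon) (loops : Bool) {n : ℕ} (u : Fin n → I) :
    WeightedGraph n where
  adj i j := if i = j ∧ loops = false then 0 else W (u i) (u j)
  symm' i j := by
    rw [W.symm' (u i) (u j)]
    simp only [eq_comm (a := i) (b := j)]
  nonneg' i j := by
    split_ifs
    · exact le_rfl
    · exact W.nonneg' _ _
  le_one' i j := by
    split_ifs
    · exact zero_le_one
    · exact W.le_one' _ _

/-- The unweighted graph sampled from `W` at the points `u₁, …, uₙ`, the unordered pair `{i, j}`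
being connected when `ξ_{ij} < W(uᵢ, uⱼ)`. If the `ξ`s are independent and uniform on `[0,1]`,
these are independent events of probability `W(uᵢ, uⱼ)` given `u`. `loops` is as above. -/
noncomputable def Graphon.stochasticSample (W : Graphon) (loops : Bool) {n : ℕ} (u : Fin n → I)
    (ξ : Sym2 (Fin n) → I) : WeightedGraph n where
  adj i j :=
    if i = j ∧ loops = false then 0 else if (ξ s(i, j) : ℝ) < W (u i) (u j) then 1 else 0
  symm' i j := by
    rw [W.symm' (u i) (u j), Sym2.eq_swap]
    simp only [eq_comm (a := i) (b := j)]
  nonneg' i j := by split_ifs <;> norm_num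
  le_one' i j := by split_ifs <;> norm_num

/-!
The proof has three ingredients.

**Eigenvalues through quadratic forms.** By the spectral theorem for compact self-adjoint operators
the `i`-th positive eigenvalue of `T` is at least `μ` as soon as `⟨T x, x⟩ ≥ μ ‖x‖²` on a space of
dimension `i` (`le_posEigenvalue`). Hence Weyl's inequality in a form that allows a change of
variables: if a contraction `J` carries the quadratic form of `T` to that of `S` up to `ε ‖x‖²`, then
the eigenvalues drop by at most `ε` (`posEigenvalue_le_add`). Negative eigenvalues are the positive
ones of `-T`.

**The deterministic comparison.** On the normalized indicators of the cells of the regular partition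
an induced graphon acts as the matrix `A / n`. Sort the sample points by a permutation `τ`, and let
`J` average over the cells and then permute them by `τ` (`cellPerm`). Along `J` the graphon of
`(W(uⱼ, uₖ))` becomes that of the sorted points, which is uniformly within `L δ` of `W` if the `j`-th
smallest point is within `δ` of the `j`-th cell. Whatever else distinguishes `A` from `(W(uⱼ, uₖ))`,
namely a missing diagonal and the noise of the random edges, costs its quadratic form divided by `n`
(`Graphon.abs_eigenvalue_inducedGraphon_sub_le`).

**Concentration.** Both random quantities are sums of independent centred Bernoulli variables, so
Hoeffding's inequality (`volume_le_abs_sum_ite_le`) and a union bound suffice. The numbers of sample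
points below `k / n`, for `k ≤ n`, give `δ = O(√(log n / n))` (`volume_empirical_le`). For the noise,
the union is over the points of the unit ball of `ℝⁿ` with coordinates in `n⁻² ℤ`. There are at most
`n ^ (4 n)` of them, and deviations of size `√(n log n)` at a single one have probability
`n ^ (-c n)` with `c` at will. This net is fine enough for matrices with entries in `[-1, 1]`
(`abs_sum_le_of_net`, `Graphon.volume_stochastic_net_le`).
-/

/-! ### Positive eigenvalues and quadratic forms -/

section Spectral

open Module.End

variable {E : Type*} [NormedAddCommGroup E] [InnerProductSpace ℝ E]

/-- Orthogonality of the eigenspaces diagonalizes the quadratic form of `T`: here `f ν` is the squared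
norm of the component of `x` in the eigenspace of `ν`. -/
theorem exists_sum_eigenspaces {T : E →L[ℝ] E} (hT : T.IsSymmetric) {S : Set ℝ} {x : E}
    (hx : x ∈ (⨆ ν ∈ S, eigenspace (T : E →ₗ[ℝ] E) ν : Submodule ℝ E)) :
    ∃ f : S →₀ ℝ, (∀ ν, 0 ≤ f ν) ∧ ‖x‖ ^ 2 = ∑ ν ∈ f.support, f ν ∧
      inner ℝ (T x) x = ∑ ν ∈ f.support, (ν : ℝ) * f ν := by
  classical
  rw [iSup_subtype', Submodule.mem_iSup_iff_exists_finsupp] at hx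
  obtain ⟨g, hg, rfl⟩ := hx
  have hV := hT.orthogonalFamily_eigenspaces.comp (γ := S) Subtype.val_injective
  have hTg : ∀ ν : S, T (g ν) = (ν : ℝ) • g ν := fun ν => mem_eigenspace_iff.1 (hg ν)
  have hn := hV.inner_sum (fun ν => ⟨g ν, hg ν⟩) (fun ν => ⟨g ν, hg ν⟩) g.support
  have hi := hV.inner_sum (fun ν => (ν : ℝ) • ⟨g ν, hg ν⟩) (fun ν => ⟨g ν, hg ν⟩) g.support
  refine ⟨g.mapRange (fun y => ‖y‖ ^ 2) (by simp), fun ν => by simp, ?_, ?_⟩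
  · have hs : (g.mapRange (fun y => ‖y‖ ^ 2) (by simp)).support = g.support := by
      ext; simp
    rw [hs]
    simpa [Finsupp.sum] using hn
  · have hs : (g.mapRange (fun y => ‖y‖ ^ 2) (by simp)).support = g.support := by
      ext; simp
    rw [hs]
    simpa [Finsupp.sum, hTg, inner_smul_left] using hi

theorem le_inner_of_mem_iSup_eigenspace {T : E →L[ℝ] E} (hT : T.IsSymmetric) {μ : ℝ} {x : E}
    (hx : x ∈ (⨆ ν ∈ Set.Ici μ, eigenspace (T : E →ₗ[ℝ] E) ν : Submodule ℝ E)) :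
    μ * ‖x‖ ^ 2 ≤ inner ℝ (T x) x := by
  obtain ⟨f, hf, h1, h2⟩ := exists_sum_eigenspaces hT hx
  rw [h1, h2, Finset.mul_sum]
  exact Finset.sum_le_sum fun ν _ => mul_le_mul_of_nonneg_right ν.2 (hf ν)

theorem inner_le_of_mem_iSup_eigenspace {T : E →L[ℝ] E} (hT : T.IsSymmetric) {μ : ℝ} {x : E}
    (hx : x ∈ (⨆ ν ∈ Set.Iio μ, eigenspace (T : E →ₗ[ℝ] E) ν : Submodule ℝ E)) :
    inner ℝ (T x) x ≤ μ * ‖x‖ ^ 2 := by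
  obtain ⟨f, hf, h1, h2⟩ := exists_sum_eigenspaces hT hx
  rw [h1, h2, Finset.mul_sum]
  exact Finset.sum_le_sum fun ν _ => mul_le_mul_of_nonneg_right (le_of_lt ν.2) (hf ν)

/-- Off the eigenspaces of eigenvalues `≥ μ` the quadratic form of `T` is at most `μ`. Compactness
enters here: it ensures that the remaining eigenspaces span a dense subspace of the complement. -/
theorem inner_le_of_mem_orthogonal [CompleteSpace E] {T : E →L[ℝ] E} (hc : IsCompactOperator T)
    (hT : T.IsSymmetric) {μ : ℝ} {x : E}
    (hx : x ∈ (⨆ ν ∈ Set.Ici μ, eigenspace (T : E →ₗ[ℝ] E) ν : Submodule ℝ E)ᗮ) :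
    inner ℝ (T x) x ≤ μ * ‖x‖ ^ 2 := by
  set U : Submodule ℝ E := ⨆ ν ∈ Set.Ici μ, eigenspace (T : E →ₗ[ℝ] E) ν with hU
  set D : Submodule ℝ E := ⨆ ν ∈ Set.Iio μ, eigenspace (T : E →ₗ[ℝ] E) ν with hD
  have hDU : D ≤ Uᗮ := by
    rw [← Submodule.isOrtho_iff_le, hD, hU]
    simp only [Submodule.isOrtho_iSup_left, Submodule.isOrtho_iSup_right]
    intro ν hν ν' hν'
    exact hT.orthogonalFamily_eigenspaces.isOrtho
      (ne_of_lt (lt_of_lt_of_le (Set.mem_Iio.1 hν') (Set.mem_Ici.1 hν)))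
  have hsup : (U ⊔ D)ᗮ = ⊥ := by
    rw [eq_bot_iff, ← ContinuousLinearMap.orthogonalComplement_iSup_eigenspaces_eq_bot hc hT]
    refine Submodule.orthogonal_le (iSup_le fun ν => ?_)
    rcases lt_or_ge ν μ with h | h
    · exact le_sup_of_le_right (le_iSup₂_of_le ν h le_rfl)
    · exact le_sup_of_le_left (le_iSup₂_of_le ν h le_rfl)
  -- `x` lies in the closure of `D`, where the inequality extends by continuity
  have hxD : x ∈ D.topologicalClosure := by
    rw [← Submodule.orthogonal_orthogonal_eq_closure, Submodule.mem_orthogonal]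
    intro y hy
    obtain ⟨p, hp, q, hq, rfl⟩ :=
      Submodule.exists_add_mem_mem_orthogonal (K := D.topologicalClosure) x
    rw [Submodule.orthogonal_closure] at hq
    have hpU : p ∈ Uᗮ :=
      Submodule.topologicalClosure_minimal _ hDU (Submodule.isClosed_orthogonal _) hp
    have hqU : q ∈ Uᗮ := by simpa using Uᗮ.sub_mem hx hpU
    have hq0 : q ∈ (U ⊔ D)ᗮ := by
      rw [← Submodule.inf_orthogonal]
      exact ⟨hqU, hq⟩
    rw [hsup, Submodule.mem_bot] at hq0
    rw [hq0, add_zero]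
    rw [← Submodule.orthogonal_closure] at hy
    exact Submodule.inner_left_of_mem_orthogonal hp hy
  have hcl : IsClosed {x : E | inner ℝ (T x) x ≤ μ * ‖x‖ ^ 2} :=
    isClosed_le (by fun_prop) (by fun_prop)
  exact hcl.closure_subset_iff.2 (fun y hy => inner_le_of_mem_iSup_eigenspace hT hy) hxD

theorem posEigenvalue_nonneg (T : E →L[ℝ] E) (i : ℕ) : 0 ≤ posEigenvalue T i :=
  Real.sSup_nonneg fun _ h => h.1.le

theorem eigenvalue_le_norm {T : E →L[ℝ] E} {μ : ℝ}
    (h : HasEigenvalue (T : E →ₗ[ℝ] E) μ) : μ ≤ ‖T‖ := by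
  obtain ⟨v, hv⟩ := h.exists_hasEigenvector
  have h1 : T v = μ • v := hv.apply_eq_smul
  have h2 := T.le_opNorm v
  rw [h1, norm_smul] at h2
  exact (le_abs_self μ).trans (le_of_mul_le_mul_right h2 (norm_pos_iff.2 hv.2))

/-- If the eigenspaces of eigenvalues `≥ μ` span at least `i` dimensions, then so do those of
eigenvalues `≥ ν` for some actual eigenvalue `ν ≥ μ`: finitely many eigenspaces suffice. -/
theorem exists_eigenvalue_le_rank {T : E →L[ℝ] E} {μ : ℝ} {i : ℕ} (hi : i ≠ 0)
    (h : (i : Cardinal) ≤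
      Module.rank ℝ (⨆ ν ∈ Set.Ici μ, eigenspace (T : E →ₗ[ℝ] E) ν : Submodule ℝ E)) :
    ∃ ν, μ ≤ ν ∧ HasEigenvalue (T : E →ₗ[ℝ] E) ν ∧ (i : Cardinal) ≤
      Module.rank ℝ (⨆ ν' ∈ Set.Ici ν, eigenspace (T : E →ₗ[ℝ] E) ν' : Submodule ℝ E) := by
  classical
  obtain ⟨φ, hφ⟩ := Module.le_rank_iff_exists_linearMap.1 h
  set ψ : (Fin i → ℝ) →ₗ[ℝ] E := (Submodule.subtype _).comp φ with hψ
  have hψi : Function.Injective ψ := Subtype.val_injective.comp hφ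
  have hle : LinearMap.range ψ ≤ ⨆ ν : Set.Ici μ, eigenspace (T : E →ₗ[ℝ] E) (ν : ℝ) := by
    rw [iSup_subtype]
    rintro _ ⟨v, rfl⟩
    exact (φ v).2
  have hfg : (LinearMap.range ψ).FG := Module.Finite.iff_fg.1 inferInstance
  obtain ⟨s, hs⟩ := CompleteLattice.IsCompactElement.exists_finset_of_le_iSup _
    ((Submodule.fg_iff_compact _).1 hfg) _ hle
  set s' := s.filter fun ν : Set.Ici μ => HasEigenvalue (T : E →ₗ[ℝ] E) (ν : ℝ) with hs'
  have hs2 : LinearMap.range ψ ≤ ⨆ ν ∈ s', eigenspace (T : E →ₗ[ℝ] E) (ν : ℝ) := by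
    refine hs.trans (iSup₂_le fun ν hν => ?_)
    by_cases he : HasEigenvalue (T : E →ₗ[ℝ] E) (ν : ℝ)
    · exact le_iSup₂_of_le ν (Finset.mem_filter.2 ⟨hν, he⟩) le_rfl
    · rw [hasEigenvalue_iff, not_not] at he
      rw [he]
      exact bot_le
  have hne : s'.Nonempty := by
    rw [Finset.nonempty_iff_ne_empty]
    rintro h0
    rw [h0] at hs2
    have hb : LinearMap.range ψ = ⊥ := by simpa using hs2
    rw [LinearMap.range_eq_bot] at hb
    have : (fun _ => 1 : Fin i → ℝ) = 0 := hψi (by simp [hb])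
    exact one_ne_zero (congrFun this ⟨0, Nat.pos_of_ne_zero hi⟩)
  have hmin := Finset.mem_filter.1 (s'.min'_mem hne)
  refine ⟨s'.min' hne, (s'.min' hne).2, hmin.2, Module.le_rank_iff_exists_linearMap.2 ?_⟩
  have hs3 : LinearMap.range ψ ≤
      ⨆ ν' ∈ Set.Ici ((s'.min' hne : Set.Ici μ) : ℝ), eigenspace (T : E →ₗ[ℝ] E) ν' :=
    hs2.trans (iSup₂_le fun ν hν => le_iSup₂_of_le (ν : ℝ) (s'.min'_le ν hν) le_rfl)
  refine ⟨ψ.codRestrict _ fun v => hs3 ⟨v, rfl⟩, fun v w hvw => hψi ?_⟩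
  simpa using congrArg Subtype.val hvw

/-- The lower bound in the min-max principle: a space of dimension `i` on which the quadratic form
of `T` is at least `μ` forces the `i`-th positive eigenvalue to be at least `μ`. -/
theorem le_posEigenvalue [CompleteSpace E] {T : E →L[ℝ] E} (hc : IsCompactOperator T)
    (hT : T.IsSymmetric) {i : ℕ} (hi : i ≠ 0) {μ : ℝ} (φ : (Fin i → ℝ) →ₗ[ℝ] E)
    (hφ : Function.Injective φ) (h : ∀ v, μ * ‖φ v‖ ^ 2 ≤ inner ℝ (T (φ v)) (φ v)) :
    μ ≤ posEigenvalue T i := by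
  -- the strict inequality `μ' < μ` makes the two Rayleigh bounds below incompatible
  refine le_of_forall_lt_imp_le_of_dense fun μ' hμ' => ?_
  rcases le_or_gt μ' 0 with h0 | h0
  · exact h0.trans (posEigenvalue_nonneg T i)
  -- otherwise some nonzero `φ v` is orthogonal to the eigenspaces of eigenvalues `≥ μ'`
  have hrank : (i : Cardinal) ≤
      Module.rank ℝ (⨆ ν ∈ Set.Ici μ', eigenspace (T : E →ₗ[ℝ] E) ν : Submodule ℝ E) := by
    set U : Submodule ℝ E := ⨆ ν ∈ Set.Ici μ', eigenspace (T : E →ₗ[ℝ] E) ν with hU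
    by_contra hlt
    have hfin : FiniteDimensional ℝ U :=
      Module.rank_lt_aleph0_iff.1 ((not_le.1 hlt).trans (Cardinal.natCast_lt_aleph0))
    refine hlt (Module.le_rank_iff_exists_linearMap.2
      ⟨(U.orthogonalProjectionOnto : E →ₗ[ℝ] U).comp φ, ?_⟩)
    rw [← LinearMap.ker_eq_bot, LinearMap.ker_eq_bot']
    intro v hv
    have hv' : φ v ∈ Uᗮ := by
      rw [← Submodule.orthogonalProjectionOnto_eq_zero_iff]
      exact hv
    have h1 := inner_le_of_mem_orthogonal hc hT hv'
    have h2 : (μ - μ') * ‖φ v‖ ^ 2 ≤ 0 := by linarith [h v]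
    have h3 : ‖φ v‖ ^ 2 ≤ 0 := nonpos_of_mul_nonpos_right h2 (sub_pos.2 hμ')
    have h4 : φ v = 0 := by simpa using h3
    exact hφ (h4.trans (map_zero φ).symm)
  obtain ⟨ν, hν, he, hr⟩ := exists_eigenvalue_le_rank hi hrank
  exact hν.trans (le_csSup ⟨‖T‖, fun _ hx => eigenvalue_le_norm hx.2.1⟩ ⟨h0.trans_le hν, he, hr⟩)

/-- Weyl's inequality with a change of variables: if the contraction `J` carries the quadratic form
of `T` to that of `S` up to a loss of `ε`, the positive eigenvalues drop by at most `ε`. -/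
theorem posEigenvalue_le_add [CompleteSpace E] {T S : E →L[ℝ] E} (hT : T.IsSymmetric)
    (hc : IsCompactOperator S) (hS : S.IsSymmetric) {i : ℕ} (hi : i ≠ 0) {ε : ℝ} (hε : 0 ≤ ε)
    (J : E →ₗ[ℝ] E) (hJ : ∀ x, ‖J x‖ ≤ ‖x‖)
    (h : ∀ x, inner ℝ (T x) x ≤ inner ℝ (S (J x)) (J x) + ε * ‖x‖ ^ 2) :
    posEigenvalue T i ≤ posEigenvalue S i + ε := by
  refine Real.sSup_le ?_ (add_nonneg (posEigenvalue_nonneg S i) hε)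
  rintro μ ⟨hμ, -, hr⟩
  rcases le_or_gt μ ε with hμε | hμε
  · exact hμε.trans (le_add_of_nonneg_left (posEigenvalue_nonneg S i))
  obtain ⟨φ, hφ⟩ := Module.le_rank_iff_exists_linearMap.1 hr
  have key : ∀ v, (μ - ε) * ‖(φ v : E)‖ ^ 2 ≤ inner ℝ (S (J (φ v))) (J (φ v)) := fun v => by
    linarith [h (φ v), le_inner_of_mem_iSup_eigenspace hT (φ v).2]
  have hpos : 0 < μ - ε := sub_pos.2 hμε
  rw [← sub_le_iff_le_add]
  refine le_posEigenvalue hc hS hi (J.comp ((Submodule.subtype _).comp φ)) ?_ fun v => ?_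
  · rw [← LinearMap.ker_eq_bot, LinearMap.ker_eq_bot']
    intro v hv
    have hv' : J (φ v) = 0 := hv
    have h1 := key v
    rw [hv', map_zero, inner_zero_left] at h1
    have h2 : ‖(φ v : E)‖ ^ 2 ≤ 0 := nonpos_of_mul_nonpos_right h1 hpos
    have h3 : φ v = 0 := by simpa using h2
    exact hφ (h3.trans (map_zero φ).symm)
  · refine le_trans ?_ (key v)
    gcongr
    exact hJ _

end Spectral

/-! ### The graphon operator -/

namespace Graphon

theorem inner_operator (W : Graphon) (X Y : L2I) :
    inner ℝ (W.operator X) Y = ∫ v : I, ∫ u : I, W u v * X u * Y v := by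
  rw [L2.inner_def]
  refine integral_congr_ae ?_
  filter_upwards [W.operator_apply_ae X] with v hv
  rw [hv, integral_mul_const]
  simp [mul_comm]

theorem operator_isSymmetric (W : Graphon) : W.operator.IsSymmetric := by
  intro X Y
  change inner ℝ (W.operator X) Y = inner ℝ X (W.operator Y)
  have hint : Integrable (Function.uncurry fun v u : I => W u v * X u * Y v)
      ((volume : Measure I).prod volume) := by
    have h1 : Integrable (fun z : I × I => Y z.1 * X z.2) ((volume : Measure I).prod volume) :=
      (integrable_L2I Y).mul_prod (integrable_L2I X)
    have h2 := h1.bdd_mul (c := 1) (f := fun z : I × I => W z.2 z.1)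
      (W.measurable'.comp measurable_swap).aestronglyMeasurable
      (Filter.Eventually.of_forall fun z => W.norm_le_one z.2 z.1)
    refine h2.congr (Filter.Eventually.of_forall fun z => ?_)
    simp only [Function.uncurry]
    ring
  rw [real_inner_comm (W.operator Y) X, inner_operator, inner_operator, integral_integral_swap hint]
  refine integral_congr_ae (Filter.Eventually.of_forall fun v => ?_)
  refine integral_congr_ae (Filter.Eventually.of_forall fun u => ?_)
  simp only
  rw [W.symm' u v]
  ring

/-- On a probability space the operator norm is at most the sup norm of the kernel. -/
theorem norm_operator_sub_le {W W' : Graphon} {ε : ℝ} (hε : 0 ≤ ε)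
    (h : ∀ x y, |W x y - W' x y| ≤ ε) : ‖W.operator - W'.operator‖ ≤ ε := by
  refine ContinuousLinearMap.opNorm_le_bound _ hε fun X => ?_
  have hb : ∀ᵐ v ∂(volume : Measure I), ‖(W.operator - W'.operator) X v‖ ≤ ε * ‖X‖ := by
    rw [sub_apply]
    filter_upwards [Lp.coeFn_sub (W.operator X) (W'.operator X), W.operator_apply_ae X,
      W'.operator_apply_ae X] with v h1 h2 h3
    rw [h1, Pi.sub_apply, h2, h3,
      ← integral_sub (W.integrable_kernel_mul X v) (W'.integrable_kernel_mul X v)]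
    calc ‖∫ u : I, (W u v * X u - W' u v * X u)‖ ≤ ∫ u : I, ε * ‖X u‖ := by
          refine norm_integral_le_of_norm_le ((integrable_L2I X).norm.const_mul ε)
            (Filter.Eventually.of_forall fun u => ?_)
          rw [← sub_mul, norm_mul]
          exact mul_le_mul_of_nonneg_right (h u v) (norm_nonneg _)
      _ ≤ ε * ‖X‖ := by
          rw [integral_const_mul]
          exact mul_le_mul_of_nonneg_left (integral_norm_le X) hε
  have h1 : measureUnivNNReal (volume : Measure I) = 1 := by simp [measureUnivNNReal]
  have h2 := Lp.norm_le_of_ae_bound (mul_nonneg hε (norm_nonneg X)) hb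
  rw [h1] at h2
  simpa using h2

theorem abs_inner_operator_sub_le {W W' : Graphon} {ε : ℝ} (hε : 0 ≤ ε)
    (h : ∀ x y, |W x y - W' x y| ≤ ε) (X : L2I) :
    |inner ℝ (W.operator X) X - inner ℝ (W'.operator X) X| ≤ ε * ‖X‖ ^ 2 := by
  rw [← inner_sub_left, ← sub_apply]
  refine (abs_real_inner_le_norm _ _).trans ?_
  rw [pow_two, ← mul_assoc]
  exact mul_le_mul_of_nonneg_right ((ContinuousLinearMap.le_opNorm _ _).trans
    (mul_le_mul_of_nonneg_right (norm_operator_sub_le hε h) (norm_nonneg _))) (norm_nonneg _)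

end Graphon

/-! ### The regular partition and the operator of an induced graphon -/

theorem exists_mem_regularCell {n : ℕ} (hn : n ≠ 0) (x : I) : ∃ j : Fin n, x ∈ regularCell n j := by
  have hn' : (0 : ℝ) < n := by exact_mod_cast Nat.pos_of_ne_zero hn
  rcases lt_or_ge ⌊(n : ℝ) * x⌋₊ n with h | h
  · refine ⟨⟨_, h⟩, ?_, Or.inl ?_⟩
    · rw [div_le_iff₀' hn']
      exact Nat.floor_le (mul_nonneg hn'.le x.2.1)
    · rw [lt_div_iff₀' hn']
      exact Nat.lt_floor_add_one _
  · have h1 : (1 : ℝ) ≤ x := by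
      have := (Nat.le_floor_iff (mul_nonneg hn'.le x.2.1)).1 h
      nlinarith
    refine ⟨⟨n - 1, by omega⟩, ?_, Or.inr (by simp; omega)⟩
    refine le_trans ?_ h1
    rw [div_le_one hn']
    exact_mod_cast Nat.sub_le n 1

theorem le_of_mem_regularCell {n : ℕ} {j : Fin n} {x : I} (h : x ∈ regularCell n j) :
    (x : ℝ) ≤ ((j : ℝ) + 1) / n := by
  rcases h.2 with h | h
  · exact h.le
  · have hn : (0 : ℝ) < n := by exact_mod_cast j.pos
    have h' : (j : ℝ) + 1 = n := by exact_mod_cast h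
    rw [h', div_self hn.ne']
    exact x.2.2

theorem volume_regularCell {n : ℕ} (j : Fin n) :
    (volume : Measure I).real (regularCell n j) = 1 / n := by
  have hn : (0 : ℝ) < n := by exact_mod_cast j.pos
  have hj : (j : ℝ) + 1 ≤ n := by exact_mod_cast j.isLt
  have ha : (j : ℝ) / n ∈ I := ⟨by positivity, by rw [div_le_one hn]; linarith⟩
  have hb : ((j : ℝ) + 1) / n ∈ I := ⟨by positivity, by rw [div_le_one hn]; linarith⟩
  have hsub : ((j : ℝ) + 1) / n - (j : ℝ) / n = 1 / n := by ring
  have hm : (volume : Measure I) (regularCell n j) = ENNReal.ofReal (1 / n) := by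
    apply le_antisymm
    · rw [← hsub]
      refine (measure_mono (t := Set.Icc (⟨_, ha⟩ : I) ⟨_, hb⟩) fun x hx => ?_).trans_eq
        (unitInterval.volume_Icc _ _)
      exact ⟨hx.1, le_of_mem_regularCell hx⟩
    · rw [← hsub]
      refine (unitInterval.volume_Ico (⟨_, ha⟩ : I) ⟨_, hb⟩).symm.le.trans
        (measure_mono fun x hx => ?_)
      exact ⟨hx.1, Or.inl hx.2⟩
  rw [Measure.real, hm, ENNReal.toReal_ofReal (by positivity)]

theorem MeasureTheory.Lp.coeFn_sum_ae {α ι : Type*} [MeasurableSpace α] {μ : Measure α}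
    (s : Finset ι) (f : ι → Lp ℝ 2 μ) : ⇑(∑ i ∈ s, f i) =ᵐ[μ] ∑ i ∈ s, ⇑(f i) := by
  classical
  induction s using Finset.induction_on with
  | empty => simpa using Lp.coeFn_zero ℝ 2 μ
  | insert a s ha ih =>
    rw [Finset.sum_insert ha, Finset.sum_insert ha]
    exact (Lp.coeFn_add _ _).trans (Filter.EventuallyEq.rfl.add ih)

/-- The `L²`-normalized indicator function of a cell of the regular partition; the cell has measure
`1 / n`, whence the factor `√n`. -/
noncomputable def cellVec (n : ℕ) (j : Fin n) : Graphon.L2I :=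
  indicatorConstLp 2 (measurableSet_regularCell n j) (measure_ne_top _ _) (√n)

theorem cellVec_ae (n : ℕ) (j : Fin n) : ∀ᵐ v ∂(volume : Measure I),
    cellVec n j v = √n * (regularCell n j).indicator (fun _ => (1 : ℝ)) v := by
  filter_upwards [indicatorConstLp_coeFn (p := 2) (hs := measurableSet_regularCell n j)
    (hμs := measure_ne_top (volume : Measure I) _) (c := √n)] with v hv
  rw [cellVec, hv]
  by_cases h : v ∈ regularCell n j <;> simp [h]

theorem inner_cellVec {n : ℕ} (j : Fin n) (X : Graphon.L2I) :
    inner ℝ (cellVec n j) X = √n * ∫ u in regularCell n j, X u := by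
  rw [cellVec, L2.inner_indicatorConstLp_eq_inner_setIntegral]
  simp [mul_comm]

theorem orthonormal_cellVec (n : ℕ) : Orthonormal ℝ (cellVec n) := by
  classical
  rw [orthonormal_iff_ite]
  intro j k
  have hn : (0 : ℝ) < n := by exact_mod_cast j.pos
  rw [inner_cellVec]
  have h1 : ∫ u in regularCell n j, cellVec n k u =
      ∫ u in regularCell n j, (regularCell n k).indicator (fun _ => √n) u :=
    integral_congr_ae (ae_restrict_of_ae indicatorConstLp_coeFn)
  rw [h1]
  split_ifs with h
  · subst h
    rw [setIntegral_indicator (measurableSet_regularCell n j), Set.inter_self, setIntegral_const,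
      volume_regularCell, smul_eq_mul]
    have := Real.mul_self_sqrt hn.le
    field_simp
    nlinarith
  · rw [setIntegral_indicator (measurableSet_regularCell n k)]
    have : regularCell n j ∩ regularCell n k = ∅ :=
      Set.eq_empty_of_forall_notMem fun x hx => h (regularCell_unique hx.1 hx.2)
    simp [this]

namespace WeightedGraph

variable {n : ℕ} (G : WeightedGraph n)

theorem inducedGraphon_apply {j k : Fin n} {x y : I} (hx : x ∈ regularCell n j)
    (hy : y ∈ regularCell n k) : G.inducedGraphon x y = G.adj j k := by
  change ∑ j : Fin n, ∑ k : Fin n, G.adj j k *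
    (regularCell n j).indicator (fun _ => (1 : ℝ)) x *
    (regularCell n k).indicator (fun _ => (1 : ℝ)) y = _
  rw [Finset.sum_eq_single j, Finset.sum_eq_single k]
  · simp [hx, hy]
  · intro k' _ hk'
    rw [Set.indicator_of_notMem (s := regularCell n k') fun h => hk' (regularCell_unique h hy),
      mul_zero]
  · simp
  · intro j' _ hj'
    simp [Set.indicator_of_notMem (s := regularCell n j') fun h => hj' (regularCell_unique h hx)]
  · simp

theorem operator_inducedGraphon_apply (X : Graphon.L2I) :
    G.inducedGraphon.operator X =
      ∑ j, ∑ k, (G.adj j k / n * inner ℝ (cellVec n j) X) • cellVec n k := by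
  apply Lp.ext
  have hcoe : ⇑(∑ j, ∑ k, (G.adj j k / n * inner ℝ (cellVec n j) X) • cellVec n k) =ᵐ[volume]
      ∑ j, ∑ k, (G.adj j k / n * inner ℝ (cellVec n j) X) • ⇑(cellVec n k) := by
    refine (Lp.coeFn_sum_ae _ _).trans (eventuallyEq_sum fun j _ => ?_)
    refine (Lp.coeFn_sum_ae _ _).trans (eventuallyEq_sum fun k _ => Lp.coeFn_smul _ _)
  have hcell := ae_all_iff.2 (cellVec_ae n)
  filter_upwards [hcoe, hcell, G.inducedGraphon.operator_apply_ae X] with v h1 h2 h3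
  rw [h1, h3]
  simp only [Finset.sum_apply, Pi.smul_apply, h2, smul_eq_mul, inner_cellVec]
  change ∫ u : I, (∑ j : Fin n, ∑ k : Fin n, G.adj j k *
    (regularCell n j).indicator (fun _ => (1 : ℝ)) u *
    (regularCell n k).indicator (fun _ => (1 : ℝ)) v) * X u = _
  have hre : ∀ u : I, (∑ j : Fin n, ∑ k : Fin n, G.adj j k *
      (regularCell n j).indicator (fun _ => (1 : ℝ)) u *
      (regularCell n k).indicator (fun _ => (1 : ℝ)) v) * X u =
      ∑ j : Fin n, (∑ k : Fin n, G.adj j k *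
        (regularCell n k).indicator (fun _ => (1 : ℝ)) v) * (regularCell n j).indicator X u := by
    intro u
    rw [Finset.sum_mul]
    refine Finset.sum_congr rfl fun j _ => ?_
    rw [Finset.sum_mul, Finset.sum_mul]
    refine Finset.sum_congr rfl fun k _ => ?_
    by_cases hu : u ∈ regularCell n j <;> simp [hu]
  simp only [hre]
  rw [integral_finsetSum _ fun j _ =>
    ((Graphon.integrable_L2I X).indicator (measurableSet_regularCell n j)).const_mul _]
  refine Finset.sum_congr rfl fun j _ => ?_
  have hn : (0 : ℝ) < n := by exact_mod_cast j.pos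
  rw [integral_const_mul, integral_indicator (measurableSet_regularCell n j), Finset.sum_mul]
  refine Finset.sum_congr rfl fun k _ => ?_
  have := Real.mul_self_sqrt hn.le
  field_simp
  rw [Real.sq_sqrt hn.le]

theorem inner_operator_inducedGraphon (X : Graphon.L2I) :
    inner ℝ (G.inducedGraphon.operator X) X =
      (∑ j, ∑ k, G.adj j k * inner ℝ (cellVec n j) X * inner ℝ (cellVec n k) X) / n := by
  rw [operator_inducedGraphon_apply]
  simp only [sum_inner, inner_smul_left, Finset.sum_div]
  refine Finset.sum_congr rfl fun j _ => Finset.sum_congr rfl fun k _ => ?_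
  simp
  ring

theorem isCompactOperator_inducedGraphon : IsCompactOperator G.inducedGraphon.operator := by
  have h : G.inducedGraphon.operator = ∑ j, ∑ k, (G.adj j k / n) •
      (innerSL ℝ (cellVec n j)).smulRight (cellVec n k) := by
    ext1 X
    rw [operator_inducedGraphon_apply]
    simp [smul_smul]
  rw [h]
  refine Submodule.sum_mem (compactOperator (RingHom.id ℝ) Graphon.L2I Graphon.L2I) fun j _ =>
    Submodule.sum_mem _ fun k _ => Submodule.smul_mem _ _ ?_
  have h1 : IsCompactOperator (innerSL ℝ (cellVec n j)) :=
    isCompactOperator_of_locallyCompactSpace_dom (innerSL ℝ (cellVec n j))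
  exact h1.clm_comp (ContinuousLinearMap.toSpanSingleton ℝ (cellVec n k))

end WeightedGraph

/-! ### Comparison of the eigenvalues of a graph and a Lipschitz graphon -/

/-- Two-sided comparison of positive eigenvalues along a pair of contractions, of which `J` is a
right inverse of `J'` as far as the quadratic form of `S` can see. -/
theorem abs_posEigenvalue_sub_le {E : Type*} [NormedAddCommGroup E] [InnerProductSpace ℝ E]
    [CompleteSpace E] {T S : E →L[ℝ] E} (hTc : IsCompactOperator T) (hT : T.IsSymmetric)
    (hSc : IsCompactOperator S) (hS : S.IsSymmetric) {i : ℕ} (hi : i ≠ 0) {ε : ℝ} (hε : 0 ≤ ε)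
    (J J' : E →ₗ[ℝ] E) (hJ : ∀ x, ‖J x‖ ≤ ‖x‖) (hJ' : ∀ x, ‖J' x‖ ≤ ‖x‖)
    (h : ∀ x, |inner ℝ (S (J x)) (J x) - inner ℝ (T x) x| ≤ ε * ‖x‖ ^ 2)
    (hinv : ∀ y, inner ℝ (S (J (J' y))) (J (J' y)) = inner ℝ (S y) y) :
    |posEigenvalue S i - posEigenvalue T i| ≤ ε := by
  have h1 : posEigenvalue T i ≤ posEigenvalue S i + ε :=
    posEigenvalue_le_add hT hSc hS hi hε J hJ fun x => by linarith [(abs_le.1 (h x)).1]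
  have h2 : posEigenvalue S i ≤ posEigenvalue T i + ε := by
    refine posEigenvalue_le_add hS hTc hT hi hε J' hJ' fun y => ?_
    have h3 := (abs_le.1 (h (J' y))).2
    rw [hinv] at h3
    have h4 : ε * ‖J' y‖ ^ 2 ≤ ε * ‖y‖ ^ 2 := by
      gcongr
      exact hJ' y
    linarith
  rw [abs_le]
  constructor <;> linarith

section CellPerm

variable {n : ℕ}

theorem sum_sq_inner_cellVec_le (X : Graphon.L2I) :
    ∑ j, inner ℝ (cellVec n j) X ^ 2 ≤ ‖X‖ ^ 2 := by
  simpa using (orthonormal_cellVec n).sum_inner_products_le X (s := Finset.univ)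

/-- Averaging over the cells of the regular partition, followed by the permutation `τ` of the
cells. -/
noncomputable def cellPerm (τ : Equiv.Perm (Fin n)) : Graphon.L2I →ₗ[ℝ] Graphon.L2I :=
  ∑ j, ((innerSL ℝ (cellVec n j)).smulRight (cellVec n (τ j)) : Graphon.L2I →ₗ[ℝ] Graphon.L2I)

theorem cellPerm_apply (τ : Equiv.Perm (Fin n)) (X : Graphon.L2I) :
    cellPerm τ X = ∑ j, inner ℝ (cellVec n (τ.symm j)) X • cellVec n j := by
  rw [← Equiv.sum_comp τ]
  simp [cellPerm]

theorem inner_cellVec_cellPerm (τ : Equiv.Perm (Fin n)) (X : Graphon.L2I) (k : Fin n) :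
    inner ℝ (cellVec n k) (cellPerm τ X) = inner ℝ (cellVec n (τ.symm k)) X := by
  rw [cellPerm_apply]
  exact (orthonormal_cellVec n).inner_right_fintype _ k

theorem norm_cellPerm_le (τ : Equiv.Perm (Fin n)) (X : Graphon.L2I) : ‖cellPerm τ X‖ ≤ ‖X‖ := by
  have h : ‖cellPerm τ X‖ ^ 2 = ∑ j, inner ℝ (cellVec n (τ.symm j)) X ^ 2 := by
    rw [← real_inner_self_eq_norm_sq]
    conv_lhs => rw [cellPerm_apply, (orthonormal_cellVec n).inner_sum]
    simp [pow_two]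
  rw [Equiv.sum_comp τ.symm fun j => inner ℝ (cellVec n j) X ^ 2] at h
  exact le_of_sq_le_sq (h.le.trans (sum_sq_inner_cellVec_le X)) (norm_nonneg _)

end CellPerm

namespace Graphon

variable {W : Graphon} {L : ℝ≥0}

theorem abs_sub_weightedSample_le (hW : LipschitzWith L (fun p : I × I => W p.1 p.2)) {n : ℕ}
    (hn : n ≠ 0) {v : Fin n → I} {δ : ℝ}
    (hv : ∀ j, ∀ x ∈ regularCell n j, |(v j : ℝ) - x| ≤ δ) (x y : I) :
    |(W.weightedSample true v).inducedGraphon x y - W x y| ≤ L * δ := by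
  obtain ⟨j, hj⟩ := exists_mem_regularCell hn x
  obtain ⟨k, hk⟩ := exists_mem_regularCell hn y
  rw [WeightedGraph.inducedGraphon_apply _ hj hk]
  have h1 : (W.weightedSample true v).adj j k = W (v j) (v k) := by simp [weightedSample]
  have h2 := hW.dist_le_mul (v j, v k) (x, y)
  rw [h1]
  rw [Real.dist_eq] at h2
  refine h2.trans (mul_le_mul_of_nonneg_left ?_ L.2)
  exact max_le (hv j x hj) (hv k y hk)

/-- The operator of a Lipschitz graphon is the norm limit of the finite rank operators obtained by
sampling at the left end points of the cells. -/
theorem isCompactOperator_of_lipschitz (hW : LipschitzWith L (fun p : I × I => W p.1 p.2)) :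
    IsCompactOperator W.operator := by
  have hp : ∀ (n : ℕ) (j : Fin n), (j : ℝ) / n ∈ I := fun n j => by
    refine ⟨by positivity, ?_⟩
    rw [div_le_one (by exact_mod_cast j.pos)]
    exact_mod_cast j.isLt.le
  set F : ℕ → L2I →L[ℝ] L2I := fun n =>
    (W.weightedSample true fun j : Fin (n + 1) => ⟨_, hp _ j⟩).inducedGraphon.operator with hF
  have hle : ∀ n, ‖F n - W.operator‖ ≤ L * (1 / ((n : ℝ) + 1)) := by
    intro n
    refine norm_operator_sub_le (mul_nonneg L.2 (by positivity)) fun x y =>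
      abs_sub_weightedSample_le hW n.succ_ne_zero (fun j x hx => ?_) x y
    have h1 := hx.1
    have h2 := le_of_mem_regularCell hx
    rw [add_div] at h2
    push_cast at h1 h2 ⊢
    rw [abs_le]
    constructor <;> linarith [show 0 ≤ 1 / ((n : ℝ) + 1) by positivity]
  have hlim : Filter.Tendsto F Filter.atTop (nhds W.operator) := by
    rw [tendsto_iff_norm_sub_tendsto_zero]
    refine squeeze_zero (fun _ => norm_nonneg _) hle ?_
    simpa using tendsto_one_div_add_atTop_nhds_zero_nat.const_mul (L : ℝ)
  exact isCompactOperator_of_tendsto hlim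
    (Filter.Eventually.of_forall fun n => WeightedGraph.isCompactOperator_inducedGraphon _)

/-- The deterministic comparison. If the permutation `τ` moves the sampled points `u` to within `δ`
of the cells of the regular partition, and the quadratic form of the adjacency matrix of `G` differs
from that of `(W(uⱼ, uₖ))` by at most `η`, then all eigenvalues differ by at most `L δ + η / n`. -/
theorem abs_eigenvalue_inducedGraphon_sub_le
    (hW : LipschitzWith L (fun p : I × I => W p.1 p.2)) {n : ℕ} (hn : n ≠ 0) {u : Fin n → I}
    {τ : Equiv.Perm (Fin n)} {δ : ℝ} (hδ : 0 ≤ δ)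
    (hτ : ∀ j, ∀ x ∈ regularCell n j, |(u (τ j) : ℝ) - x| ≤ δ) {G : WeightedGraph n} {η : ℝ}
    (hη0 : 0 ≤ η) (hη : ∀ x : Fin n → ℝ,
      |∑ j, ∑ k, (G.adj j k - W (u j) (u k)) * x j * x k| ≤ η * ∑ j, x j ^ 2) {i : ℤ}
    (hi : i ≠ 0) :
    |G.inducedGraphon.eigenvalue i - W.eigenvalue i| ≤ L * δ + η / n := by
  set ε := (L : ℝ) * δ + η / n with hε
  have hLδ : 0 ≤ (L : ℝ) * δ := mul_nonneg L.2 hδ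
  have hε0 : 0 ≤ ε := add_nonneg hLδ (by positivity)
  have hn' : (0 : ℝ) < n := by exact_mod_cast Nat.pos_of_ne_zero hn
  have key : ∀ X, |inner ℝ (G.inducedGraphon.operator (cellPerm τ X)) (cellPerm τ X)
      - inner ℝ (W.operator X) X| ≤ ε * ‖X‖ ^ 2 := by
    intro X
    set x : Fin n → ℝ := fun j => inner ℝ (cellVec n (τ.symm j)) X with hx
    have hx2 : ∑ j, x j ^ 2 ≤ ‖X‖ ^ 2 := by
      rw [hx, Equiv.sum_comp τ.symm fun j => inner ℝ (cellVec n j) X ^ 2]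
      exact sum_sq_inner_cellVec_le X
    -- the graph of the sorted points, whose graphon is uniformly close to `W`
    set G' := W.weightedSample true (u ∘ τ) with hG'
    have h1 : inner ℝ (G'.inducedGraphon.operator X) X =
        (∑ j, ∑ k, W (u j) (u k) * x j * x k) / n := by
      rw [WeightedGraph.inner_operator_inducedGraphon, ← Equiv.sum_comp τ fun j => ∑ k,
        W (u j) (u k) * x j * x k]
      congr 1
      refine Finset.sum_congr rfl fun j _ => ?_
      rw [← Equiv.sum_comp τ fun k => W (u (τ j)) (u k) * x (τ j) * x k]
      refine Finset.sum_congr rfl fun k _ => ?_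
      simp [hx, hG', weightedSample]
    have h2 := abs_inner_operator_sub_le hLδ (abs_sub_weightedSample_le hW hn hτ) X
    have h3 : |inner ℝ (G.inducedGraphon.operator (cellPerm τ X)) (cellPerm τ X)
        - inner ℝ (G'.inducedGraphon.operator X) X| ≤ η / n * ‖X‖ ^ 2 := by
      rw [h1, WeightedGraph.inner_operator_inducedGraphon]
      simp only [inner_cellVec_cellPerm]
      rw [← sub_div, ← Finset.sum_sub_distrib]
      simp only [← Finset.sum_sub_distrib]
      have h5 := hη x
      simp only [sub_mul] at h5
      rw [abs_div, abs_of_pos hn', div_mul_eq_mul_div]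
      exact div_le_div_of_nonneg_right
        (h5.trans (mul_le_mul_of_nonneg_left hx2 hη0)) hn'.le
    have h4 := abs_sub_le (inner ℝ (G.inducedGraphon.operator (cellPerm τ X)) (cellPerm τ X))
      (inner ℝ (G'.inducedGraphon.operator X) X) (inner ℝ (W.operator X) X)
    rw [hε, add_mul]
    exact h4.trans (by rw [add_comm]; exact add_le_add h2 h3)
  have hinv : ∀ Y, inner ℝ (G.inducedGraphon.operator (cellPerm τ (cellPerm τ.symm Y)))
      (cellPerm τ (cellPerm τ.symm Y)) = inner ℝ (G.inducedGraphon.operator Y) Y := by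
    intro Y
    rw [WeightedGraph.inner_operator_inducedGraphon, WeightedGraph.inner_operator_inducedGraphon]
    simp [inner_cellVec_cellPerm]
  have hGc := G.isCompactOperator_inducedGraphon
  have hWc := isCompactOperator_of_lipschitz hW
  have hGs := G.inducedGraphon.operator_isSymmetric
  have hWs := W.operator_isSymmetric
  have hneg : ∀ {V : Graphon}, (-V.operator).IsSymmetric := fun {V} X Y => by
    have := V.operator_isSymmetric X Y
    simpa using this
  unfold eigenvalue
  split_ifs with h0
  · exact abs_posEigenvalue_sub_le hWc hWs hGc hGs (by omega) hε0 (cellPerm τ) (cellPerm τ.symm)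
      (norm_cellPerm_le τ) (norm_cellPerm_le τ.symm) key hinv
  · rw [neg_sub_neg, abs_sub_comm]
    refine abs_posEigenvalue_sub_le hWc.neg hneg hGc.neg hneg (by omega) hε0 (cellPerm τ)
      (cellPerm τ.symm) (norm_cellPerm_le τ) (norm_cellPerm_le τ.symm) (fun X => ?_) fun Y => ?_
    · have := key X
      rw [abs_sub_comm] at this
      simpa [neg_add_eq_sub] using this
    · simpa using hinv Y

end Graphon

/-! ### Hoeffding's inequality for independent edges and points -/

section Hoeffding

open ProbabilityTheory

theorem integral_ite_lt {w : ℝ} (hw : w ∈ Set.Icc (0 : ℝ) 1) :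
    ∫ x : I, (if (x : ℝ) < w then (1 : ℝ) else 0) = w := by
  have h : (fun x : I => if (x : ℝ) < w then (1 : ℝ) else 0) =
      (Set.Iio (⟨w, hw⟩ : I)).indicator 1 := by
    ext x
    by_cases hx : (x : ℝ) < w
    · have : x ∈ Set.Iio (⟨w, hw⟩ : I) := hx
      simp [hx, this]
    · have : x ∉ Set.Iio (⟨w, hw⟩ : I) := hx
      simp [hx, this]
  rw [h, integral_indicator_one measurableSet_Iio, Measure.real, unitInterval.volume_Iio,
    ENNReal.toReal_ofReal hw.1]

theorem measurable_ite_lt (w : ℝ) : Measurable fun x : I => if (x : ℝ) < w then (1 : ℝ) else 0 :=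
  Measurable.ite (measurableSet_lt measurable_subtype_coe measurable_const)
    measurable_const measurable_const

variable {ι : Type*} [Fintype ι]

/-- The variance proxy is a quarter of any upper bound of `∑ c²`, so that one bound serves all
coefficient vectors, the zero vector included. -/
theorem hasSubgaussianMGF_sum_ite {w : ι → ℝ} (hw : ∀ e, w e ∈ Set.Icc (0 : ℝ) 1) (c : ι → ℝ)
    {s : ℝ≥0} (hs : ∑ e, c e ^ 2 ≤ s) :
    HasSubgaussianMGF
      (fun ξ : ι → I => ∑ e, c e * ((if (ξ e : ℝ) < w e then (1 : ℝ) else 0) - w e)) (s / 4)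
      volume := by
  have hX : ∀ e, HasSubgaussianMGF
      (fun x : I => (if (x : ℝ) < w e then (1 : ℝ) else 0) - w e) ((‖(1 : ℝ) - 0‖₊ / 2) ^ 2)
      volume := fun e => by
    have := hasSubgaussianMGF_of_mem_Icc (μ := (volume : Measure I)) (a := 0) (b := 1)
      (measurable_ite_lt (w e)).aemeasurable
      (Filter.Eventually.of_forall fun x => by split_ifs <;> simp)
    rwa [integral_ite_lt (hw e)] at this
  have hind : iIndepFun (fun e (ξ : ι → I) =>
      c e * ((if (ξ e : ℝ) < w e then (1 : ℝ) else 0) - w e)) (volume : Measure (ι → I)) :=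
    iIndepFun_pi (X := fun e (x : I) => c e * ((if (x : ℝ) < w e then (1 : ℝ) else 0) - w e))
      fun e => (((measurable_ite_lt (w e)).sub_const _).const_mul _).aemeasurable
  have hsub : ∀ e, HasSubgaussianMGF (fun ξ : ι → I =>
      c e * ((if (ξ e : ℝ) < w e then (1 : ℝ) else 0) - w e))
      (c e ^ 2 / 4).toNNReal volume := fun e => by
    have h1 := (hX e).const_mul (c e)
    rw [← (measurePreserving_eval (fun _ : ι => (volume : Measure I)) e).map_eq] at h1
    convert! HasSubgaussianMGF.of_map
      (Y := (Function.eval e : (ι → I) → I)) (measurable_pi_apply e).aemeasurable h1 using 1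
    apply NNReal.eq
    rw [Real.coe_toNNReal _ (by positivity)]
    change _ = c e ^ 2 * (‖(1 : ℝ) - 0‖ / 2) ^ 2
    norm_num
    ring
  have hsum := HasSubgaussianMGF.sum_of_iIndepFun hind (s := Finset.univ) fun e _ => hsub e
  refine ⟨hsum.integrable_exp_mul, fun t => (hsum.mgf_le t).trans ?_⟩
  gcongr
  rw [← NNReal.coe_le_coe]
  push_cast
  rw [Finset.sum_congr rfl fun e _ => Real.coe_toNNReal (c e ^ 2 / 4) (by positivity),
    ← Finset.sum_div]
  gcongr

/-- Hoeffding's inequality for weighted sums of centred Bernoulli variables, the variable of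
parameter `w e` being realized as the indicator of `ξ e < w e` for `ξ e` uniform on `[0,1]`. -/
theorem volume_le_abs_sum_ite_le {w : ι → ℝ} (hw : ∀ e, w e ∈ Set.Icc (0 : ℝ) 1) (c : ι → ℝ)
    {s : ℝ≥0} (hs : ∑ e, c e ^ 2 ≤ s) {t : ℝ} (ht : 0 ≤ t) :
    (volume : Measure (ι → I))
        {ξ | t ≤ |∑ e, c e * ((if (ξ e : ℝ) < w e then (1 : ℝ) else 0) - w e)|} ≤
      ENNReal.ofReal (2 * Real.exp (-(2 * t ^ 2 / s))) := by
  have h := hasSubgaussianMGF_sum_ite hw c hs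
  have h1 := h.measure_ge_le ht
  have h2 := h.neg.measure_ge_le ht
  have he : -t ^ 2 / (2 * ((s / 4 : ℝ≥0) : ℝ)) = -(2 * t ^ 2 / s) := by
    push_cast
    rcases eq_or_ne (s : ℝ) 0 with h0 | h0
    · simp [h0]
    · field_simp
      norm_num
  rw [he] at h1 h2
  rw [← ofReal_measureReal]
  refine ENNReal.ofReal_le_ofReal ?_
  rw [two_mul]
  refine le_trans (measureReal_mono ?_) ((measureReal_union_le _ _).trans (add_le_add h1 h2))
  intro ξ hξ
  rw [Set.mem_ofPred_eq] at hξ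
  rcases le_abs.1 hξ with h | h
  · exact Or.inl h
  · exact Or.inr h

end Hoeffding

/-! ### Order statistics -/

section OrderStatistics

/-- If the empirical distribution function of `u` is within `d` of the identity on the grid `k / n`,
then the order statistics of `u` are within `d + 1 / n` of the cells of the regular partition. -/
theorem abs_sort_sub_le {n : ℕ} {u : Fin n → I} {d : ℝ} (hd : 0 ≤ d)
    (h : ∀ k ≤ n, |∑ i, ((if (u i : ℝ) < (k : ℝ) / n then (1 : ℝ) else 0) - (k : ℝ) / n)| ≤ n * d)
    (j : Fin n) (x : I) (hx : x ∈ regularCell n j) :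
    |(u (Tuple.sort u j) : ℝ) - x| ≤ d + 1 / n := by
  have hn : (0 : ℝ) < n := by exact_mod_cast j.pos
  set v : Fin n → I := fun j => u (Tuple.sort u j) with hv
  have hmono : Monotone v := Tuple.monotone_sort u
  have hcount : ∀ k ≤ n, |(∑ i, if (v i : ℝ) < (k : ℝ) / n then (1 : ℝ) else 0) - k| ≤ n * d := by
    intro k hk
    have h1 := h k hk
    rw [Finset.sum_sub_distrib, ← Equiv.sum_comp (Tuple.sort u)] at h1
    simpa [mul_div_cancel₀, hn.ne'] using h1
  -- at most `j` points lie below any `t ≤ v j`, at least `j + 1` below any `t > v j`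
  have hup : ∀ t : ℝ, t ≤ v j → (∑ i, if (v i : ℝ) < t then (1 : ℝ) else 0) ≤ j := by
    intro t ht
    calc (∑ i, if (v i : ℝ) < t then (1 : ℝ) else 0) ≤ ∑ i, if i < j then (1 : ℝ) else 0 := by
          refine Finset.sum_le_sum fun i _ => ?_
          by_cases hij : i < j
          · simp only [hij, if_true]
            split_ifs <;> norm_num
          · have : ¬ (v i : ℝ) < t := not_lt.2 (ht.trans (hmono (not_lt.1 hij)))
            simp [hij, this]
      _ = j := by
          rw [Finset.sum_boole, ← Fin.card_Iio j]
          congr 2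
          ext
          simp
  have hlow : ∀ t : ℝ, (v j : ℝ) < t → (j : ℝ) + 1 ≤ ∑ i, if (v i : ℝ) < t then (1 : ℝ) else 0 := by
    intro t ht
    calc (j : ℝ) + 1 = ∑ i, if i ≤ j then (1 : ℝ) else 0 := by
          have h1 : (Finset.univ.filter fun i => i ≤ j) = Finset.Iic j := by
            ext
            simp
          rw [Finset.sum_boole, h1, Fin.card_Iic]
          push_cast
          rfl
      _ ≤ _ := by
          refine Finset.sum_le_sum fun i _ => ?_
          by_cases hij : i ≤ j
          · have : (v i : ℝ) < t := lt_of_le_of_lt (hmono hij) ht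
            simp [hij, this]
          · simp only [hij, if_false]
            split_ifs <;> norm_num
  -- `k / n ≤ v j < (k + 1) / n`; the grid point `(k + 1) / n` is not available for `k = n`
  set k := ⌊(n : ℝ) * v j⌋₊ with hk
  have hk1 : (k : ℝ) / n ≤ v j := by
    rw [div_le_iff₀' hn]
    exact Nat.floor_le (mul_nonneg hn.le (v j).2.1)
  have hk2 : (v j : ℝ) < ((k + 1 : ℕ) : ℝ) / n := by
    rw [lt_div_iff₀' hn]
    push_cast
    exact Nat.lt_floor_add_one _
  have hkn : k ≤ n := by
    have h1 : (k : ℝ) ≤ n := by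
      have := (div_le_iff₀ hn).1 (hk1.trans (v j).2.2)
      linarith
    exact_mod_cast h1
  have hA : (v j : ℝ) ≤ (j : ℝ) / n + d + 1 / n := by
    have h1 := (abs_le.1 (hcount k hkn)).1
    have h2 := hup _ hk1
    have h3 : (k : ℝ) + 1 ≤ j + n * d + 1 := by linarith
    refine hk2.le.trans ?_
    push_cast
    calc ((k : ℝ) + 1) / n ≤ (j + n * d + 1) / n := by gcongr
      _ = _ := by field_simp
  have hB : (j : ℝ) / n - d ≤ v j := by
    rcases hkn.lt_or_eq with hlt | heq
    · have h1 := (abs_le.1 (hcount (k + 1) hlt)).2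
      have h2 := hlow _ hk2
      refine le_trans ?_ hk1
      push_cast at h1 h2
      rw [le_div_iff₀ hn, sub_mul, div_mul_cancel₀ _ hn.ne']
      linarith
    · rw [heq, div_self hn.ne'] at hk1
      have : (j : ℝ) / n ≤ 1 := by
        rw [div_le_one hn]
        exact_mod_cast j.isLt.le
      linarith
  have hx1 := hx.1
  have hx2 := le_of_mem_regularCell hx
  rw [add_div] at hx2
  rw [abs_le]
  constructor <;> linarith

end OrderStatistics

/-! ### Quadratic forms on a net of the unit ball -/

section Net

/-- Rounding towards zero, which does not increase norms. -/
theorem exists_int_abs_le (r : ℝ) : ∃ k : ℤ, |(k : ℝ)| ≤ |r| ∧ |r - k| ≤ 1 := by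
  rcases le_total 0 r with h | h
  · refine ⟨⌊r⌋, ?_, ?_⟩
    · rw [abs_of_nonneg h, abs_of_nonneg (by exact_mod_cast Int.floor_nonneg.2 h)]
      exact Int.floor_le r
    · rw [abs_le]
      constructor <;> linarith [Int.floor_le r, Int.lt_floor_add_one r]
  · have hc : (⌈r⌉ : ℝ) ≤ 0 := by exact_mod_cast Int.ceil_le.2 (by simpa using h)
    refine ⟨⌈r⌉, ?_, ?_⟩
    · rw [abs_of_nonpos h, abs_of_nonpos hc]
      linarith [Int.le_ceil r]
    · rw [abs_le]
      constructor <;> linarith [Int.le_ceil r, Int.ceil_lt_add_one r]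

theorem abs_sum_le_of_unit {n : ℕ} (hn : n ≠ 0) {M : Fin n → Fin n → ℝ} (hM : ∀ j k, |M j k| ≤ 1)
    {t : ℝ} (h : ∀ y : Fin n → ℤ, (∀ j, |y j| ≤ (n : ℤ) ^ 2) →
      ∑ j, ((y j : ℝ) / (n : ℝ) ^ 2) ^ 2 ≤ 1 →
      |∑ j, ∑ k, M j k * ((y j : ℝ) / (n : ℝ) ^ 2) * ((y k : ℝ) / (n : ℝ) ^ 2)| ≤ t)
    {x : Fin n → ℝ} (hx : ∑ j, x j ^ 2 = 1) :
    |∑ j, ∑ k, M j k * x j * x k| ≤ t + 2 := by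
  have hn' : (0 : ℝ) < n := by exact_mod_cast Nat.pos_of_ne_zero hn
  have hn2 : (0 : ℝ) < (n : ℝ) ^ 2 := by positivity
  have hx1 : ∀ j, |x j| ≤ 1 := fun j => by
    rw [← sq_le_one_iff_abs_le_one, ← hx]
    exact Finset.single_le_sum (f := fun j => x j ^ 2) (fun i _ => sq_nonneg _) (Finset.mem_univ j)
  choose y hy1 hy2 using fun j => exists_int_abs_le ((n : ℝ) ^ 2 * x j)
  set z : Fin n → ℝ := fun j => (y j : ℝ) / (n : ℝ) ^ 2 with hz
  have hz1 : ∀ j, |z j| ≤ |x j| := fun j => by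
    rw [hz]
    simp only
    rw [abs_div, abs_of_pos hn2, div_le_iff₀ hn2]
    refine (hy1 j).trans_eq ?_
    rw [abs_mul, abs_of_pos hn2, mul_comm]
  have hz2 : ∀ j, |x j - z j| ≤ 1 / (n : ℝ) ^ 2 := fun j => by
    have e : x j - z j = ((n : ℝ) ^ 2 * x j - y j) / (n : ℝ) ^ 2 := by
      rw [sub_div, mul_div_cancel_left₀ _ hn2.ne']
    rw [e, abs_div, abs_of_pos hn2]
    exact div_le_div_of_nonneg_right (hy2 j) hn2.le
  have hsum : ∑ j, z j ^ 2 ≤ 1 := by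
    rw [← hx]
    exact Finset.sum_le_sum fun j _ => sq_le_sq.2 (hz1 j)
  have hty := h y (fun j => by
    have : |(y j : ℝ)| ≤ (n : ℝ) ^ 2 := (hy1 j).trans (by
      rw [abs_mul, abs_of_pos hn2]
      exact mul_le_of_le_one_right hn2.le (hx1 j))
    exact_mod_cast this) hsum
  have hdiff : |(∑ j, ∑ k, M j k * x j * x k) - ∑ j, ∑ k, M j k * z j * z k| ≤ 2 := by
    rw [← Finset.sum_sub_distrib]
    simp only [← Finset.sum_sub_distrib]
    calc |∑ j, ∑ k, (M j k * x j * x k - M j k * z j * z k)|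
        ≤ ∑ j : Fin n, ∑ k : Fin n, 2 / (n : ℝ) ^ 2 := by
          refine (Finset.abs_sum_le_sum_abs _ _).trans (Finset.sum_le_sum fun j _ => ?_)
          refine (Finset.abs_sum_le_sum_abs _ _).trans (Finset.sum_le_sum fun k _ => ?_)
          have e : M j k * x j * x k - M j k * z j * z k =
              M j k * ((x j - z j) * x k + z j * (x k - z k)) := by ring
          rw [e, abs_mul]
          have h1 : |(x j - z j) * x k| ≤ 1 / (n : ℝ) ^ 2 := by
            rw [abs_mul]
            exact (mul_le_of_le_one_right (abs_nonneg _) (hx1 k)).trans (hz2 j)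
          have h2 : |z j * (x k - z k)| ≤ 1 / (n : ℝ) ^ 2 := by
            rw [abs_mul]
            exact (mul_le_of_le_one_left (abs_nonneg _) ((hz1 j).trans (hx1 j))).trans (hz2 k)
          refine (mul_le_of_le_one_left (abs_nonneg _) (hM j k)).trans ((abs_add_le _ _).trans ?_)
          refine (add_le_add h1 h2).trans_eq ?_
          ring
      _ = 2 := by
          simp
          field_simp
  have h3 := abs_sub_abs_le_abs_sub (∑ j, ∑ k, M j k * x j * x k) (∑ j, ∑ k, M j k * z j * z k)
  linarith

/-- A net argument: a quadratic form with coefficients in `[-1, 1]` is controlled on all of `ℝⁿ` by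
its values at the points of the unit ball with coordinates in `n⁻² ℤ`. -/
theorem abs_sum_le_of_net {n : ℕ} (hn : n ≠ 0) {M : Fin n → Fin n → ℝ} (hM : ∀ j k, |M j k| ≤ 1)
    {t : ℝ} (h : ∀ y : Fin n → ℤ, (∀ j, |y j| ≤ (n : ℤ) ^ 2) →
      ∑ j, ((y j : ℝ) / (n : ℝ) ^ 2) ^ 2 ≤ 1 →
      |∑ j, ∑ k, M j k * ((y j : ℝ) / (n : ℝ) ^ 2) * ((y k : ℝ) / (n : ℝ) ^ 2)| ≤ t)
    (x : Fin n → ℝ) :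
    |∑ j, ∑ k, M j k * x j * x k| ≤ (t + 2) * ∑ j, x j ^ 2 := by
  have hs0 : 0 ≤ ∑ j, x j ^ 2 := Finset.sum_nonneg fun j _ => sq_nonneg _
  rcases hs0.eq_or_lt with h0 | hpos
  · have hx : ∀ j, x j = 0 := fun j => by
      have := (Finset.sum_eq_zero_iff_of_nonneg fun j _ => sq_nonneg (x j)).1 h0.symm j
        (Finset.mem_univ j)
      simpa using this
    simp [hx]
  · set s := ∑ j, x j ^ 2 with hs
    have hr : 0 < √s := Real.sqrt_pos.2 hpos
    have hrs : √s ^ 2 = s := Real.sq_sqrt hs0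
    have h1 := abs_sum_le_of_unit hn hM h (x := fun j => x j / √s) (by
      simp only [div_pow, hrs]
      rw [← Finset.sum_div, ← hs, div_self hpos.ne'])
    have h2 : ∑ j, ∑ k, M j k * (x j / √s) * (x k / √s) = (∑ j, ∑ k, M j k * x j * x k) / s := by
      simp only [Finset.sum_div]
      refine Finset.sum_congr rfl fun j _ => Finset.sum_congr rfl fun k _ => ?_
      rw [mul_assoc, div_mul_div_comm, Real.mul_self_sqrt hs0, mul_div_assoc', mul_assoc]
    rw [h2, abs_div, abs_of_pos hpos, div_le_iff₀ hpos] at h1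
    exact h1

end Net

/-! ### Quadratic forms of symmetric matrices as sums over unordered pairs -/

section Sym2

variable {n : ℕ} (y : Fin n → ℝ)

/-- The coefficient of the unordered pair `e` in the quadratic form of a symmetric matrix at `y`:
`2 yⱼ yₖ` for `e = {j, k}` with `j ≠ k`, and `yⱼ²` for `e = {j, j}`. -/
noncomputable def sym2Coeff (e : Sym2 (Fin n)) : ℝ :=
  ∑ p : Fin n × Fin n with s(p.1, p.2) = e, y p.1 * y p.2

theorem sum_sum_eq_sum_sym2 (F : Sym2 (Fin n) → ℝ) :
    ∑ j, ∑ k, F s(j, k) * y j * y k = ∑ e, sym2Coeff y e * F e := by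
  rw [← Fintype.sum_prod_type' (fun j k => F s(j, k) * y j * y k),
    ← Finset.sum_fiberwise _ (fun p : Fin n × Fin n => s(p.1, p.2))]
  refine Finset.sum_congr rfl fun e _ => ?_
  rw [sym2Coeff, Finset.sum_mul]
  refine Finset.sum_congr (by simp) fun p hp => ?_
  rw [(Finset.mem_filter.1 hp).2]
  ring

/-- Cauchy-Schwarz on each unordered pair, which has at most two orderings. -/
theorem sum_sym2Coeff_sq_le : ∑ e, sym2Coeff y e ^ 2 ≤ 2 * (∑ j, y j ^ 2) ^ 2 := by
  calc ∑ e, sym2Coeff y e ^ 2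
      ≤ ∑ e : Sym2 (Fin n), 2 * ∑ p : Fin n × Fin n with s(p.1, p.2) = e, (y p.1 * y p.2) ^ 2 := by
        refine Finset.sum_le_sum fun e _ => ?_
        have hcard : (Finset.univ.filter fun p : Fin n × Fin n => s(p.1, p.2) = e).card ≤ 2 := by
          induction e using Sym2.ind with
          | _ a b =>
            refine (Finset.card_le_card (t := {(a, b), (b, a)}) fun p hp => ?_).trans
              Finset.card_le_two
            have := (Finset.mem_filter.1 hp).2
            rw [Sym2.eq_iff] at this
            simpa [Prod.ext_iff] using this
        refine (sq_sum_le_card_mul_sum_sq).trans ?_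
        exact mul_le_mul_of_nonneg_right (by exact_mod_cast hcard)
          (Finset.sum_nonneg fun p _ => sq_nonneg _)
    _ = 2 * (∑ j, y j ^ 2) ^ 2 := by
        rw [← Finset.mul_sum, Finset.sum_fiberwise, pow_two (∑ j, y j ^ 2), Finset.sum_mul_sum,
          ← Finset.univ_product_univ, Finset.sum_product]
        simp [mul_pow]

end Sym2

/-! ### Concentration of the sampled graph -/

/-- With probability at least `1 - n ^ (-(κ + 1))` the empirical distribution function of `n`
uniform points is within `√((κ + 4) log n / (2 n))` of the identity on the grid `k / n`. -/
theorem volume_empirical_le {κ : ℝ} (hκ : 0 < κ) {n : ℕ} (hn : 2 ≤ n) :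
    (volume : Measure (Fin n → I)) {u | ∃ k ≤ n, n * (√((κ + 4) / 2) * √(Real.log n / n)) ≤
        |∑ i, ((if (u i : ℝ) < (k : ℝ) / n then (1 : ℝ) else 0) - (k : ℝ) / n)|} ≤
      ENNReal.ofReal ((n : ℝ) ^ (-(κ + 1))) := by
  have hn0 : (0 : ℝ) < n := by exact_mod_cast (by omega : 0 < n)
  have hn2 : (2 : ℝ) ≤ n := by exact_mod_cast hn
  have hlog : 0 ≤ Real.log n := Real.log_nonneg (by linarith)
  set t : ℝ := n * (√((κ + 4) / 2) * √(Real.log n / n)) with ht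
  have ht0 : 0 ≤ t := by positivity
  have ht2 : 2 * t ^ 2 / n = (κ + 4) * Real.log n := by
    rw [ht, mul_pow, mul_pow, Real.sq_sqrt (by positivity), Real.sq_sqrt (by positivity)]
    field_simp
  have hone : ∀ k ≤ n, (volume : Measure (Fin n → I)) {u | t ≤
      |∑ i, ((if (u i : ℝ) < (k : ℝ) / n then (1 : ℝ) else 0) - (k : ℝ) / n)|} ≤
      ENNReal.ofReal (2 * (n : ℝ) ^ (-(κ + 4))) := by
    intro k hk
    have hw : (k : ℝ) / n ∈ Set.Icc (0 : ℝ) 1 := by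
      refine ⟨by positivity, ?_⟩
      rw [div_le_one hn0]
      exact_mod_cast hk
    have h := volume_le_abs_sum_ite_le (ι := Fin n) (w := fun _ => (k : ℝ) / n) (fun _ => hw)
      (fun _ => 1) (s := n) (by simp) ht0
    simp only [one_mul, NNReal.coe_natCast, ht2] at h
    refine h.trans_eq ?_
    rw [Real.rpow_def_of_pos hn0]
    congr 3
    ring
  calc (volume : Measure (Fin n → I)) {u | ∃ k ≤ n, t ≤
        |∑ i, ((if (u i : ℝ) < (k : ℝ) / n then (1 : ℝ) else 0) - (k : ℝ) / n)|}
      ≤ volume (⋃ k ∈ Finset.range (n + 1), {u : Fin n → I | t ≤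
        |∑ i, ((if (u i : ℝ) < (k : ℝ) / n then (1 : ℝ) else 0) - (k : ℝ) / n)|}) := by
        refine measure_mono fun u hu => ?_
        obtain ⟨k, hk, h⟩ := hu
        exact Set.mem_biUnion (Finset.mem_coe.2 (Finset.mem_range.2 (Nat.lt_succ_of_le hk))) h
    _ ≤ ∑ k ∈ Finset.range (n + 1), ENNReal.ofReal (2 * (n : ℝ) ^ (-(κ + 4))) :=
        (measure_biUnion_finset_le _ _).trans (Finset.sum_le_sum fun k hk =>
          hone k (Nat.lt_succ_iff.1 (Finset.mem_range.1 hk)))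
    _ = ENNReal.ofReal ((n + 1) * (2 * (n : ℝ) ^ (-(κ + 4)))) := by
        rw [Finset.sum_const, Finset.card_range, nsmul_eq_mul,
          ENNReal.ofReal_mul (p := (n : ℝ) + 1) (by positivity)]
        congr 1
        exact_mod_cast (ENNReal.ofReal_natCast (n + 1)).symm
    _ ≤ _ := by
        refine ENNReal.ofReal_le_ofReal ?_
        have h3 : (n : ℝ) ^ (-(κ + 1)) = (n : ℝ) ^ 3 * (n : ℝ) ^ (-(κ + 4)) := by
          rw [← Real.rpow_natCast, ← Real.rpow_add hn0]
          congr 1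
          push_cast
          ring
        rw [h3, ← mul_assoc]
        refine mul_le_mul_of_nonneg_right ?_ (by positivity)
        nlinarith [mul_nonneg (sub_nonneg.2 hn2) (sub_nonneg.2 hn2)]

/-- A bound on all slices of a set bounds its measure in a product with a probability measure. -/
theorem MeasureTheory.Measure.prod_le_of_forall_preimage_le {α β : Type*} [MeasurableSpace α]
    [MeasurableSpace β] {μ : Measure α} [IsProbabilityMeasure μ] {ν : Measure β} [SFinite ν]
    {s : Set (α × β)} (hs : MeasurableSet s) {c : ℝ≥0∞} (h : ∀ a, ν (Prod.mk a ⁻¹' s) ≤ c) :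
    μ.prod ν s ≤ c := by
  rw [Measure.prod_apply hs]
  exact (lintegral_mono h).trans_eq (by simp)

namespace Graphon

variable (W : Graphon) {n : ℕ}

/-- The pair weights `W(uⱼ, uₖ)` as a function of the unordered pair `{j, k}`. -/
noncomputable def pairWeight (u : Fin n → I) : Sym2 (Fin n) → ℝ :=
  Sym2.lift ⟨fun j k => W (u j) (u k), fun _ _ => W.symm' _ _⟩

theorem mem_Icc_pairWeight (u : Fin n → I) (e : Sym2 (Fin n)) :
    W.pairWeight u e ∈ Set.Icc (0 : ℝ) 1 := by
  induction e using Sym2.ind with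
  | _ a b => exact ⟨W.nonneg' _ _, W.le_one' _ _⟩

/-- Hoeffding's inequality for the centred adjacency matrix, conditionally on the sample points. The
entries are independent only as a function of unordered pairs, hence the passage to `Sym2`. -/
theorem volume_stochastic_form_le (u : Fin n → I) {y : Fin n → ℝ} (hy : ∑ j, y j ^ 2 ≤ 1) {t : ℝ}
    (ht : 0 ≤ t) :
    (volume : Measure (Sym2 (Fin n) → I)) {ξ | t ≤ |∑ j, ∑ k,
        ((W.stochasticSample true u ξ).adj j k - W (u j) (u k)) * y j * y k|} ≤
      ENNReal.ofReal (2 * Real.exp (-t ^ 2)) := by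
  have h := volume_le_abs_sum_ite_le (W.mem_Icc_pairWeight u) (sym2Coeff y) (s := 2) (by
    refine (sum_sym2Coeff_sq_le y).trans ?_
    have h0 : 0 ≤ ∑ j, y j ^ 2 := Finset.sum_nonneg fun j _ => sq_nonneg _
    have := pow_le_one₀ (n := 2) h0 hy
    push_cast
    linarith) ht
  have e : 2 * t ^ 2 / ((2 : ℝ≥0) : ℝ) = t ^ 2 := by
    push_cast
    ring
  rw [e] at h
  refine le_trans (le_of_eq ?_) h
  congr 1
  ext ξ
  rw [Set.mem_ofPred_eq, Set.mem_ofPred_eq, ← sum_sum_eq_sum_sym2 y fun e =>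
    (if (ξ e : ℝ) < W.pairWeight u e then (1 : ℝ) else 0) - W.pairWeight u e]
  simp only [stochasticSample, Bool.true_eq_false, and_false, if_false]
  rfl

theorem measurable_stochastic_form (y : Fin n → ℝ) :
    Measurable fun ω : (Fin n → I) × (Sym2 (Fin n) → I) => ∑ j, ∑ k,
      ((W.stochasticSample true ω.1 ω.2).adj j k - W (ω.1 j) (ω.1 k)) * y j * y k := by
  refine Finset.measurable_sum _ fun j _ => Finset.measurable_sum _ fun k _ => ?_
  have hW : Measurable fun ω : (Fin n → I) × (Sym2 (Fin n) → I) => W (ω.1 j) (ω.1 k) := by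
    have hp : Measurable fun ω : (Fin n → I) × (Sym2 (Fin n) → I) => (ω.1 j, ω.1 k) := by fun_prop
    exact W.measurable'.comp hp
  have hξ : Measurable fun ω : (Fin n → I) × (Sym2 (Fin n) → I) => (ω.2 s(j, k) : ℝ) :=
    measurable_subtype_coe.comp ((measurable_pi_apply _).comp measurable_snd)
  have hA : Measurable fun ω : (Fin n → I) × (Sym2 (Fin n) → I) =>
      (W.stochasticSample true ω.1 ω.2).adj j k := by
    simp only [stochasticSample, Bool.true_eq_false, and_false, if_false]
    exact Measurable.ite (measurableSet_lt hξ hW) measurable_const measurable_const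
  exact ((hA.sub hW).mul_const _).mul_const _

/-- With probability at least `1 - n ^ (-(κ + 1))` the quadratic form of the centred adjacency
matrix is below `√((κ + 6) n log n)` at all points of the unit ball with coordinates in `n⁻² ℤ`. -/
theorem volume_stochastic_net_le {κ : ℝ} (hκ : 0 < κ) (hn : 2 ≤ n) :
    (volume : Measure ((Fin n → I) × (Sym2 (Fin n) → I)))
        {ω | ∃ y : Fin n → ℤ, (∀ j, |y j| ≤ (n : ℤ) ^ 2) ∧
          ∑ j, ((y j : ℝ) / (n : ℝ) ^ 2) ^ 2 ≤ 1 ∧ √((κ + 6) * n * Real.log n) ≤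
          |∑ j, ∑ k, ((W.stochasticSample true ω.1 ω.2).adj j k - W (ω.1 j) (ω.1 k)) *
            ((y j : ℝ) / (n : ℝ) ^ 2) * ((y k : ℝ) / (n : ℝ) ^ 2)|} ≤
      ENNReal.ofReal ((n : ℝ) ^ (-(κ + 1))) := by
  classical
  have hn0 : (0 : ℝ) < n := by exact_mod_cast (by omega : 0 < n)
  have hn2 : (2 : ℝ) ≤ n := by exact_mod_cast hn
  have hlog : 0 ≤ Real.log n := Real.log_nonneg (by linarith)
  set t : ℝ := √((κ + 6) * n * Real.log n) with ht
  have ht2 : t ^ 2 = (κ + 6) * n * Real.log n := Real.sq_sqrt (by positivity)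
  set N : Finset (Fin n → ℤ) := (Fintype.piFinset fun _ => Finset.Icc (-(n : ℤ) ^ 2) ((n : ℤ) ^ 2))
    with hN
  set N' := N.filter fun y => ∑ j, ((y j : ℝ) / (n : ℝ) ^ 2) ^ 2 ≤ 1 with hN'
  have hcard : (N'.card : ℝ) ≤ ((n : ℝ) ^ 4) ^ n := by
    have h1 : N'.card ≤ (2 * n ^ 2 + 1) ^ n := by
      refine (Finset.card_filter_le _ _).trans_eq ?_
      rw [hN, Fintype.card_piFinset]
      simp only [Int.card_Icc, Finset.prod_const, Finset.card_univ, Fintype.card_fin]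
      congr 1
      zify
      rw [Int.toNat_of_nonneg (by linarith [sq_nonneg (n : ℤ)])]
      ring
    have h2 : (N'.card : ℝ) ≤ (2 * (n : ℝ) ^ 2 + 1) ^ n := by exact_mod_cast h1
    refine h2.trans (pow_le_pow_left₀ (by positivity) ?_ n)
    nlinarith [mul_le_mul hn2 hn2 (by norm_num) hn0.le, sq_nonneg ((n : ℝ) ^ 2 - 4)]
  set S : (Fin n → ℤ) → Set ((Fin n → I) × (Sym2 (Fin n) → I)) := fun y => {ω | t ≤
    |∑ j, ∑ k, ((W.stochasticSample true ω.1 ω.2).adj j k - W (ω.1 j) (ω.1 k)) *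
            ((y j : ℝ) / (n : ℝ) ^ 2) * ((y k : ℝ) / (n : ℝ) ^ 2)|} with hS
  have hone : ∀ y ∈ N', (volume : Measure ((Fin n → I) × (Sym2 (Fin n) → I))) (S y) ≤
      ENNReal.ofReal (2 * Real.exp (-t ^ 2)) := by
    intro y hy
    refine Measure.prod_le_of_forall_preimage_le ?_ fun u => ?_
    · exact measurableSet_le measurable_const
        (W.measurable_stochastic_form fun j => (y j : ℝ) / (n : ℝ) ^ 2).norm
    · exact W.volume_stochastic_form_le u (Finset.mem_filter.1 hy).2 (Real.sqrt_nonneg _)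
  calc _ ≤ (volume : Measure ((Fin n → I) × (Sym2 (Fin n) → I))) (⋃ y ∈ N', S y) := by
        refine measure_mono fun ω hω => ?_
        obtain ⟨y, h1, h2, h3⟩ := hω
        refine Set.mem_biUnion (Finset.mem_coe.2 (Finset.mem_filter.2 ⟨?_, h2⟩)) h3
        rw [hN, Fintype.mem_piFinset]
        exact fun j => Finset.mem_Icc.2 (abs_le.1 (h1 j))
    _ ≤ ∑ y ∈ N', ENNReal.ofReal (2 * Real.exp (-t ^ 2)) :=
        (measure_biUnion_finset_le _ _).trans (Finset.sum_le_sum hone)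
    _ = ENNReal.ofReal (N'.card * (2 * Real.exp (-t ^ 2))) := by
        rw [Finset.sum_const, nsmul_eq_mul, ENNReal.ofReal_mul (p := (N'.card : ℝ)) (by positivity),
          ENNReal.ofReal_natCast]
    _ ≤ _ := by
        refine ENNReal.ofReal_le_ofReal ?_
        have hexp : Real.exp (-t ^ 2) = ((n : ℝ) ^ (-(κ + 6))) ^ n := by
          rw [Real.rpow_def_of_pos hn0, ← Real.exp_nat_mul, ht2]
          congr 1
          ring
        have h4 : (n : ℝ) ^ 4 * (n : ℝ) ^ (-(κ + 6)) = (n : ℝ) ^ (-(κ + 2)) := by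
          rw [← Real.rpow_natCast, ← Real.rpow_add hn0]
          congr 1
          push_cast
          ring
        have h5 : (n : ℝ) ^ (-(κ + 1)) = n * (n : ℝ) ^ (-(κ + 2)) := by
          nth_rewrite 2 [← Real.rpow_one (n : ℝ)]
          rw [← Real.rpow_add hn0]
          congr 1
          ring
        have h6 : (n : ℝ) ^ (-(κ + 2)) ≤ 1 :=
          Real.rpow_le_one_of_one_le_of_nonpos (by linarith) (by linarith)
        have h7 : ((n : ℝ) ^ (-(κ + 2))) ^ n ≤ (n : ℝ) ^ (-(κ + 2)) :=
          pow_le_of_le_one (by positivity) h6 (by omega)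
        calc N'.card * (2 * Real.exp (-t ^ 2))
            ≤ ((n : ℝ) ^ 4) ^ n * (2 * Real.exp (-t ^ 2)) := by gcongr
          _ = 2 * ((n : ℝ) ^ (-(κ + 2))) ^ n := by
              rw [hexp, ← h4, mul_pow]
              ring
          _ ≤ n * (n : ℝ) ^ (-(κ + 2)) := mul_le_mul hn2 h7 (by positivity) hn0.le
          _ = _ := h5.symm

theorem abs_diag_sum_le {M : Fin n → Fin n → ℝ} (hM : ∀ j, |M j j| ≤ 1)
    (hM0 : ∀ j k, j ≠ k → M j k = 0) (x : Fin n → ℝ) :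
    |∑ j, ∑ k, M j k * x j * x k| ≤ ∑ j, x j ^ 2 := by
  refine (Finset.abs_sum_le_sum_abs _ _).trans (Finset.sum_le_sum fun j _ => ?_)
  rw [Finset.sum_eq_single j (fun k _ hk => by rw [hM0 j k hk.symm]; ring) (by simp), mul_assoc,
    abs_mul, ← pow_two, abs_of_nonneg (sq_nonneg (x j))]
  exact mul_le_of_le_one_left (sq_nonneg _) (hM j)

theorem abs_weightedSample_form_le (loops : Bool) (u : Fin n → I) (x : Fin n → ℝ) :
    |∑ j, ∑ k, ((W.weightedSample loops u).adj j k - W (u j) (u k)) * x j * x k| ≤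
      1 * ∑ j, x j ^ 2 := by
  rw [one_mul]
  refine abs_diag_sum_le (M := fun j k => (W.weightedSample loops u).adj j k - W (u j) (u k))
    (fun j => ?_) (fun j k hjk => by simp [weightedSample, hjk]) x
  have h0 := (W.weightedSample loops u).nonneg' j j
  have h1 := (W.weightedSample loops u).le_one' j j
  rw [abs_le]
  constructor <;> linarith [W.nonneg' (u j) (u j), W.le_one' (u j) (u j)]

/-- Removing the loops changes the quadratic form of the adjacency matrix by at most `∑ xⱼ²`. -/
theorem abs_stochasticSample_form_le (loops : Bool) {u : Fin n → I} {ξ : Sym2 (Fin n) → I} {η : ℝ}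
    (h : ∀ x : Fin n → ℝ, |∑ j, ∑ k, ((W.stochasticSample true u ξ).adj j k - W (u j) (u k)) *
      x j * x k| ≤ η * ∑ j, x j ^ 2) (x : Fin n → ℝ) :
    |∑ j, ∑ k, ((W.stochasticSample loops u ξ).adj j k - W (u j) (u k)) * x j * x k| ≤
      (η + 1) * ∑ j, x j ^ 2 := by
  have h1 := abs_diag_sum_le (M := fun j k => (W.stochasticSample loops u ξ).adj j k -
    (W.stochasticSample true u ξ).adj j k) (fun j => by
      have h1 := (W.stochasticSample loops u ξ).nonneg' j j
      have h2 := (W.stochasticSample loops u ξ).le_one' j j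
      have h3 := (W.stochasticSample true u ξ).nonneg' j j
      have h4 := (W.stochasticSample true u ξ).le_one' j j
      rw [abs_le]
      constructor <;> linarith) (fun j k hjk => by simp [stochasticSample, hjk]) x
  have e : ∑ j, ∑ k, ((W.stochasticSample loops u ξ).adj j k - W (u j) (u k)) * x j * x k =
      ∑ j, ∑ k, ((W.stochasticSample true u ξ).adj j k - W (u j) (u k)) * x j * x k +
      ∑ j, ∑ k, ((W.stochasticSample loops u ξ).adj j k -
        (W.stochasticSample true u ξ).adj j k) * x j * x k := by
    rw [← Finset.sum_add_distrib]
    refine Finset.sum_congr rfl fun j _ => ?_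
    rw [← Finset.sum_add_distrib]
    refine Finset.sum_congr rfl fun k _ => ?_
    ring
  rw [e, add_mul, one_mul]
  exact (abs_add_le _ _).trans (add_le_add (h x) h1)

end Graphon

/-! ### The Lipschitz case -/

theorem mainTheorem2 (L : ℝ≥0) (κ : ℝ) (hκ : 0 < κ) :
    ∃ C : ℝ, 0 < C ∧ ∀ W : Graphon, LipschitzWith L (fun p : I × I => W p.1 p.2) →
      ∀ (loops : Bool) (n : ℕ), 2 ≤ n →
        (volume : Measure (Fin n → I))
            {u | ∃ i : ℤ, i ≠ 0 ∧ C * √(Real.log n / n) <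
              |(W.weightedSample loops u).inducedGraphon.eigenvalue i - W.eigenvalue i|}
          ≤ ENNReal.ofReal ((n : ℝ) ^ (-κ)) ∧
        (volume : Measure ((Fin n → I) × (Sym2 (Fin n) → I)))
            {ω | ∃ i : ℤ, i ≠ 0 ∧ C * √(Real.log n / n) <
              |(W.stochasticSample loops ω.1 ω.2).inducedGraphon.eigenvalue i
                - W.eigenvalue i|}
          ≤ ENNReal.ofReal ((n : ℝ) ^ (-κ)) := by
  -- the summands bound the irregularity of the sample points, the noise of the random edges, and
  -- the loops with the rounding to the net
  refine ⟨L * (√((κ + 4) / 2) + 1) + √(κ + 6) + 3, by positivity, fun W hW loops n hn => ?_⟩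
  have hn0 : (0 : ℝ) < n := by exact_mod_cast (by omega : 0 < n)
  have hn2 : (2 : ℝ) ≤ n := by exact_mod_cast hn
  have hn' : n ≠ 0 := by omega
  have hlog : 0 ≤ Real.log n := Real.log_nonneg (by linarith)
  set r : ℝ := √(Real.log n / n) with hr
  set a : ℝ := √((κ + 4) / 2) with ha
  set t : ℝ := √((κ + 6) * n * Real.log n) with ht
  have hr0 : 0 ≤ r := Real.sqrt_nonneg _
  have ha0 : 0 ≤ a := Real.sqrt_nonneg _
  have hb0 : 0 ≤ √(κ + 6) := Real.sqrt_nonneg _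
  -- absorbs the width of the cells, the diagonal and the rounding to the net; `n log n ≥ 1`
  -- since `n ≥ 2`
  have hinv : 1 / (n : ℝ) ≤ r := by
    refine Real.le_sqrt_of_sq_le ?_
    have h1 : 1 ≤ n * Real.log n := by
      have h2 := Real.log_two_gt_d9
      have h3 := Real.log_le_log (by norm_num) hn2
      nlinarith
    rw [div_pow, one_pow, div_le_div_iff₀ (by positivity) hn0]
    nlinarith
  have htn : t / n = √(κ + 6) * r := by
    have e : (κ + 6) * n * Real.log n = (κ + 6) * (Real.log n / n) * (n : ℝ) ^ 2 := by field_simp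
    rw [hr, ht, ← Real.sqrt_mul (by positivity), div_eq_iff hn0.ne', e,
      Real.sqrt_mul (by positivity), Real.sqrt_sq hn0.le]
  -- the two bad events: irregular sample points, and large noise of the adjacency matrix
  set B₁ : Set (Fin n → I) := {u | ∃ k ≤ n, n * (a * r) ≤
    |∑ i, ((if (u i : ℝ) < (k : ℝ) / n then (1 : ℝ) else 0) - (k : ℝ) / n)|} with hB₁
  set B₂ : Set ((Fin n → I) × (Sym2 (Fin n) → I)) := {ω | ∃ y : Fin n → ℤ,
    (∀ j, |y j| ≤ (n : ℤ) ^ 2) ∧ ∑ j, ((y j : ℝ) / (n : ℝ) ^ 2) ^ 2 ≤ 1 ∧ t ≤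
      |∑ j, ∑ k, ((W.stochasticSample true ω.1 ω.2).adj j k - W (ω.1 j) (ω.1 k)) *
        ((y j : ℝ) / (n : ℝ) ^ 2) * ((y k : ℝ) / (n : ℝ) ^ 2)|} with hB₂
  have hvol₁ : (volume : Measure (Fin n → I)) B₁ ≤ ENNReal.ofReal ((n : ℝ) ^ (-(κ + 1))) :=
    volume_empirical_le hκ hn
  have hvol₂ : (volume : Measure ((Fin n → I) × (Sym2 (Fin n) → I))) B₂ ≤
      ENNReal.ofReal ((n : ℝ) ^ (-(κ + 1))) := W.volume_stochastic_net_le hκ hn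
  have hpow : 2 * (n : ℝ) ^ (-(κ + 1)) ≤ (n : ℝ) ^ (-κ) := by
    have h1 : (n : ℝ) ^ (-κ) = n * (n : ℝ) ^ (-(κ + 1)) := by
      nth_rewrite 2 [← Real.rpow_one (n : ℝ)]
      rw [← Real.rpow_add hn0]
      congr 1
      ring
    rw [h1]
    exact mul_le_mul_of_nonneg_right hn2 (by positivity)
  have hpow0 : 0 ≤ (n : ℝ) ^ (-(κ + 1)) := by positivity
  have hsort : ∀ u, u ∉ B₁ → ∀ j, ∀ x ∈ regularCell n j,
      |(u (Tuple.sort u j) : ℝ) - x| ≤ a * r + 1 / n := fun u hu =>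
    abs_sort_sub_le (mul_nonneg ha0 hr0) fun k hk => by
      by_contra hlt
      exact hu ⟨k, hk, (not_le.1 hlt).le⟩
  have hδ : 0 ≤ a * r + 1 / (n : ℝ) := by positivity
  constructor
  · refine (measure_mono fun u hu => ?_).trans (hvol₁.trans (ENNReal.ofReal_le_ofReal (by linarith)))
    by_contra hB
    obtain ⟨i, hi, hlt⟩ := hu
    have h := Graphon.abs_eigenvalue_inducedGraphon_sub_le hW hn' hδ (hsort u hB) zero_le_one
      (W.abs_weightedSample_form_le loops u) hi
    refine absurd (hlt.trans_le h) (not_lt.2 ?_)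
    have h1 : (L : ℝ) * (a * r + 1 / n) ≤ L * (a * r + r) := by gcongr
    nlinarith [mul_nonneg hb0 hr0]
  · have hsub : {ω : (Fin n → I) × (Sym2 (Fin n) → I) | ∃ i : ℤ, i ≠ 0 ∧
        (L * (a + 1) + √(κ + 6) + 3) * r <
          |(W.stochasticSample loops ω.1 ω.2).inducedGraphon.eigenvalue i - W.eigenvalue i|} ⊆
        B₁ ×ˢ Set.univ ∪ B₂ := by
      rintro ⟨u, ξ⟩ ⟨i, hi, hlt⟩
      by_contra hB
      rw [Set.mem_union, not_or] at hB
      have hB1 : u ∉ B₁ := fun h => hB.1 ⟨h, Set.mem_univ _⟩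
      have hnet := abs_sum_le_of_net hn'
        (M := fun j k => (W.stochasticSample true u ξ).adj j k - W (u j) (u k))
        (fun j k => by
          have h0 := (W.stochasticSample true u ξ).nonneg' j k
          have h1 := (W.stochasticSample true u ξ).le_one' j k
          rw [abs_le]
          constructor <;> linarith [W.nonneg' (u j) (u k), W.le_one' (u j) (u k)])
        (t := t) (fun y hy1 hy2 => by
          by_contra hlt
          exact hB.2 ⟨y, hy1, hy2, (not_le.1 hlt).le⟩)
      have h := Graphon.abs_eigenvalue_inducedGraphon_sub_le hW hn' hδ (hsort u hB1)
        (by positivity) (W.abs_stochasticSample_form_le loops hnet) hi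
      refine absurd (hlt.trans_le h) (not_lt.2 ?_)
      have h1 : (L : ℝ) * (a * r + 1 / n) ≤ L * (a * r + r) := by gcongr
      have h2 : (t + 2 + 1) / (n : ℝ) = √(κ + 6) * r + 3 * (1 / n) := by
        rw [← htn]
        ring
      rw [h2]
      nlinarith
    refine (measure_mono hsub).trans ((measure_union_le _ _).trans ?_)
    have hprod : (volume : Measure ((Fin n → I) × (Sym2 (Fin n) → I))) (B₁ ×ˢ Set.univ) ≤
        ENNReal.ofReal ((n : ℝ) ^ (-(κ + 1))) := by
      rw [Measure.volume_eq_prod, Measure.prod_prod, measure_univ, mul_one]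
      exact hvol₁
    refine (add_le_add hprod hvol₂).trans ?_
    rw [← ENNReal.ofReal_add hpow0 hpow0]
    exact ENNReal.ofReal_le_ofReal (by linarith)
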